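/- Let $k\ge 1$ and let $p_1,\dots,p_k>0$ with $p_1+\dots+p_k=1$. **The $n$-token game.** Each of two players distributes $n$ tokens over $k$ bins, i.e. chooses an allocation $\xi\in\mathbb{Z}_{\ge 0}^k$ with $\sum_i\xi_i=n$. A $k$-sided die, showing side $i$ with probability $p_i$, is thrown repeatedly and independently; each throw of side $i$ removes one token from bin $i$ of each player who still has a token there. Let $T^{(n)}_\xi$ be the number of throws after which all tokens of a player with allocation $\xi$ are removed (the same throws are used for both players), and let $$K_n(\xi,\eta)=\tfrac12\big(\Pr[T^{(n)}_\xi<T^{(n)}_\eta]-\Pr[T^{(n)}_\eta<T^{(n)}_\xi]\big).$$ A mixed strategy $\alpha_n$ is a probability measure on the set of allocations of $n$ tokens, and $K_n(\alpha_n,\eta)=\int K_n(\xi,\eta)\,\alpha_n(d\xi)$. A sequence $(\alpha_n)$ of such strategies is *asymptotically optimal* if $\min_\eta K_n(\alpha_n,\eta)\to 0$ as $n\to\infty$, the minimum being over all allocations $\eta$ of $n$ tokens. The *rescaled law* of $\alpha_n$ is the law on $\mathbb{R}^k$ of $\big((\xi_i-np_i)/\sqrt n\big)_{1\le i\le k}$,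 where $\xi$ has law $\alpha_n$. **The continuous game.** Each player chooses a vector in $\mathbb{R}^k$ with coordinates summing to $0$. With $Z_1,\dots,Z_k$ independent standard normal random variables, the same for both players, let $$T_x=\max_i\Big(\frac{x_i}{p_i}+\frac{Z_i}{\sqrt{p_i}}\Big),\qquad K(x,y)=\tfrac12\big(\Pr[T_x<T_y]-\Pr[T_y<T_x]\big).$$ A mixed strategy is a Borel probability measure on $\mathbb{R}^k$ concentrated on $\{x:\sum_i x_i=0\}$, and $K(\alpha,\beta)=\iint K(x,y)\,\alpha(dx)\,\beta(dy)$. A mixed strategy $\alpha$ is *optimal* if there is no mixed strategy $\beta$ with $K(\beta,\alpha)>0$. **Theorem 3.1.** The continuous game has value $0$, i.e. $\sup_\alpha\inf_\beta K(\alpha,\beta)=\inf_\beta\sup_\alpha K(\alpha,\beta)=0$ over mixed strategies $\alpha,\beta$, and it has at least one optimal mixed strategy. Moreover, if $(\alpha_n)$ is an asymptotically optimal sequence of mixed strategies for the $n$-token games, and along some subsequence the rescaled laws of the $\alpha_n$ converge weakly to a probability measure $\alpha$ on $\mathbb{R}^k$, then $\alpha$ is an optimal mixed strategy of the continuous game (in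 particular it is concentrated on $\{x:\sum_i x_i=0\}$). -/

import Mathlib

open MeasureTheory ProbabilityTheory Filter Topology

noncomputable section

namespace KnockEmDown

/-- A die with `k` sides; side `i` shows with probability `prob i > 0`. -/
structure Die (k : ℕ) where
  prob : Fin k → ℝ
  prob_pos : ∀ i, 0 < prob i
  sum_prob : ∑ i, prob i = 1

variable {k : ℕ}

/-! ### The game with `n` tokens -/

/-- The law of one throw of the die. -/
def Die.law (d : Die k) : Measure (Fin k) :=
  ∑ i, ENNReal.ofReal (d.prob i) • Measure.dirac i

instance (d : Die k) : IsProbabilityMeasure d.law := by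
  constructor
  simp only [Die.law, Measure.coe_finsetSum, Finset.sum_apply, Measure.smul_apply,
    Measure.dirac_apply_of_mem (Set.mem_univ _), smul_eq_mul, mul_one]
  rw [← ENNReal.ofReal_sum_of_nonneg (fun i _ => (d.prob_pos i).le), d.sum_prob,
    ENNReal.ofReal_one]

/-- The law of an infinite sequence of independent throws of the die. -/
def Die.throws (d : Die k) : Measure (ℕ → Fin k) :=
  Measure.infinitePi (fun _ : ℕ => d.law)

/-- The number of throws among the first `t` throws of the sequence `ω` that show side `i`. -/
def count (ω : ℕ → Fin k) (t : ℕ) (i : Fin k) : ℕ :=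
  ((Finset.range t).filter (fun s => ω s = i)).card

/-- The number of throws after which all the tokens are knocked down, if bin `i` starts with `ξ i`
tokens; it is `⊤` on the null event that this never happens. -/
def tokenTime (ξ : Fin k → ℕ) (ω : ℕ → Fin k) : ℕ∞ :=
  sInf ((fun t : ℕ => (t : ℕ∞)) '' {t : ℕ | ∀ i, ξ i ≤ count ω t i})

/-- The payoff `½ (Pr[ξ beats η] - Pr[η beats ξ])`, both players using the same throws. -/
def tokenPayoff (d : Die k) (ξ η : Fin k → ℕ) : ℝ :=
  (d.throws.real {ω | tokenTime ξ ω < tokenTime η ω} -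
    d.throws.real {ω | tokenTime η ω < tokenTime ξ ω}) / 2

/-- The allocations of `n` tokens to `k` bins. -/
abbrev Allocation (k n : ℕ) : Type := {ξ : Fin k → ℕ // ∑ i, ξ i = n}

/-- The mixed strategies of the game with `n` tokens. -/
abbrev TokenStrategy (k n : ℕ) : Type := ProbabilityMeasure (Allocation k n)

/-- The payoff of a mixed strategy against an allocation, in the game with `n` tokens. -/
def tokenMixedPayoff (d : Die k) {n : ℕ} (α : TokenStrategy k n) (η : Allocation k n) : ℝ :=
  ∫ ξ, tokenPayoff d ξ.1 η.1 ∂(α : Measure (Allocation k n))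

/-- The worst-case payoff of the strategy for `n` tokens tends to `0` as `n → ∞`. (The infimum
is over a finite nonempty set, so it is a minimum.) -/
def AsymptoticallyOptimal (d : Die k) (α : ∀ n : ℕ, TokenStrategy k n) : Prop :=
  Tendsto (fun n => ⨅ η : Allocation k n, tokenMixedPayoff d (α n) η) atTop (𝓝 0)

/-- The deviations `x` with `ξ i = n * p i + x i * √n`. -/
def rescale (d : Die k) (n : ℕ) (ξ : Allocation k n) : Fin k → ℝ :=
  fun i => ((ξ.1 i : ℝ) - n * d.prob i) / √(n : ℝ)

/-- The law of the deviations of an allocation that is chosen by the mixed strategy `α`. -/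
def rescaledLaw (d : Die k) {n : ℕ} (α : TokenStrategy k n) : ProbabilityMeasure (Fin k → ℝ) :=
  α.map (f := rescale d n) (measurable_of_countable _).aemeasurable

/-! ### The continuous game -/

/-- The clearance time `max_i (x_i / p_i + z_i / √p_i)`. -/
def contTime (d : Die k) (x z : Fin k → ℝ) : ℝ :=
  ⨆ i, (x i / d.prob i + z i / √(d.prob i))

/-- The law of `k` independent standard normal random variables. -/
def normals (k : ℕ) : Measure (Fin k → ℝ) :=
  Measure.pi (fun _ => gaussianReal 0 1)

/-- The payoff `½ (Pr[x beats y] - Pr[y beats x])`, both players using the same normals. -/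
def contPayoff (d : Die k) (x y : Fin k → ℝ) : ℝ :=
  ((normals k).real {z | contTime d x z < contTime d y z} -
    (normals k).real {z | contTime d y z < contTime d x z}) / 2

/-- `α` is a mixed strategy of the continuous game: it is concentrated on the allocations, which
are the vectors that sum to `0`. -/
def IsContStrategy (α : ProbabilityMeasure (Fin k → ℝ)) : Prop :=
  ∀ᵐ x ∂(α : Measure (Fin k → ℝ)), ∑ i, x i = 0

/-- The mixed strategies of the continuous game. -/
abbrev ContStrategy (k : ℕ) : Type :=
  {α : ProbabilityMeasure (Fin k → ℝ) // IsContStrategy α}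

/-- The payoff of the mixed strategy `α` against the mixed strategy `β`. -/
def contMixedPayoff (d : Die k) (α β : ProbabilityMeasure (Fin k → ℝ)) : ℝ :=
  ∫ y, ∫ x, contPayoff d x y ∂(α : Measure (Fin k → ℝ)) ∂(β : Measure (Fin k → ℝ))

/-- The continuous game has value `v`: the supremum over the first player's mixed strategies of
the worst-case payoff, and the infimum over the second player's mixed strategies of the best-case
payoff, both are `v`. -/
def HasValue (d : Die k) (v : ℝ) : Prop :=
  (⨆ α : ContStrategy k, ⨅ β : ContStrategy k,
      ((contMixedPayoff d α.1 β.1 : ℝ) : EReal)) = (v : EReal) ∧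
  (⨅ β : ContStrategy k, ⨆ α : ContStrategy k,
      ((contMixedPayoff d α.1 β.1 : ℝ) : EReal)) = (v : EReal)

/-- `α` is an optimal strategy of the continuous game: it is a mixed strategy and no mixed strategy
dominates it. -/
def IsOptimal (d : Die k) (α : ProbabilityMeasure (Fin k → ℝ)) : Prop :=
  IsContStrategy α ∧
    ∀ β : ProbabilityMeasure (Fin k → ℝ), IsContStrategy β → ¬ 0 < contMixedPayoff d β α

end KnockEmDown

end

namespace KnockEmDown

variable {k : ℕ}

/-! ### Elementary properties of the continuous game -/

/-! Everything is reduced to one condition on `α`: `lossProb d α y ≤ 1 / 2` for every `y` with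
coordinates summing to `0`. The payoff is discontinuous in the allocations because of ties, but
`lossProb` is the mass of an open event, hence lower semicontinuous for weak convergence, and the
condition passes to weak limits.

The condition implies optimality (`isOptimal_of_lossProb_le`). If `α` almost surely shares no
coordinate with `y`, ties are null and the payoff against `y` is `1 / 2 - lossProb d α y`. A general
`y` is replaced by `y ± e w` with `e → 0` generic: at a tie almost surely one common bin is last for
both players, so the two perturbations break the tie in opposite directions and the mean of the two
payoffs tends to the payoff at `y`.

Existence (`exists_isOptimal`): by minimax, each finite subgame has a strategy with nonnegative
payoffs, and its support lies in a ball independent of the subgame (`exists_bound_support`).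
Measures on that ball form a weakly compact set, and the finite intersection property gives one `α`
satisfying the condition for all `y`. Antisymmetry then gives value `0`.

Weak limits (`lossProb_le_of_tendsto`): by the central limit theorem the count of side `i` after `n
+ c √n` throws is about `n p_i + √n (p_i (s + c) - √p_i Z_i)`, where `s = ∑ √p_j Z_j`. So deviations
`y` are cleared by then when `T_y < s + c`. The shift `s` is common to both players, and if `y`
beats `x` in the continuous game, some `c` from a countable dense set separates the two times.
Finitely many `c` and a positive margin give open events that transfer to the `n`-token games. -/

theorem Die.nonempty (d : Die k) : Nonempty (Fin k) := by
  by_contra h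
  rw [not_nonempty_iff] at h
  simpa using d.sum_prob

theorem Die.sqrt_prob_pos (d : Die k) (i : Fin k) : 0 < √(d.prob i) :=
  Real.sqrt_pos.2 (d.prob_pos i)

instance : IsProbabilityMeasure (normals k) := by
  unfold normals
  infer_instance

theorem contTime_lt_iff (d : Die k) {x z : Fin k → ℝ} {t : ℝ} :
    contTime d x z < t ↔ ∀ i, x i / d.prob i + z i / √(d.prob i) < t := by
  have := d.nonempty
  exact (Set.finite_range _).csSup_lt_iff (Set.range_nonempty _) |>.trans Set.forall_mem_range

theorem lt_contTime_iff (d : Die k) {x z : Fin k → ℝ} {t : ℝ} :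
    t < contTime d x z ↔ ∃ i, t < x i / d.prob i + z i / √(d.prob i) := by
  have := d.nonempty
  exact lt_ciSup_iff (Set.finite_range _).bddAbove

theorem le_contTime (d : Die k) (x z : Fin k → ℝ) (i : Fin k) :
    x i / d.prob i + z i / √(d.prob i) ≤ contTime d x z :=
  le_ciSup (f := fun i => x i / d.prob i + z i / √(d.prob i)) (Set.finite_range _).bddAbove i

theorem exists_eq_contTime (d : Die k) (x z : Fin k → ℝ) :
    ∃ i, x i / d.prob i + z i / √(d.prob i) = contTime d x z := by
  have := d.nonempty
  exact exists_eq_ciSup_of_finite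

theorem continuous_contTime (d : Die k) :
    Continuous fun q : (Fin k → ℝ) × (Fin k → ℝ) => contTime d q.1 q.2 := by
  have := d.nonempty
  have h : (fun q : (Fin k → ℝ) × (Fin k → ℝ) => contTime d q.1 q.2) = fun q =>
      Finset.univ.sup' Finset.univ_nonempty
        (fun i => q.1 i / d.prob i + q.2 i / √(d.prob i)) := by
    ext q
    rw [Finset.sup'_univ_eq_ciSup]
    rfl
  rw [h]
  refine Continuous.finset_sup'_apply _ fun i _ => ?_
  fun_prop

@[fun_prop]
theorem continuous_contTime_comp {X : Type*} [TopologicalSpace X] (d : Die k)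
    {f g : X → Fin k → ℝ} (hf : Continuous f) (hg : Continuous g) :
    Continuous fun q => contTime d (f q) (g q) :=
  (continuous_contTime d).comp (hf.prodMk hg)

@[fun_prop]
theorem measurable_contTime_comp {X : Type*} [MeasurableSpace X] (d : Die k)
    {f g : X → Fin k → ℝ} (hf : Measurable f) (hg : Measurable g) :
    Measurable fun q => contTime d (f q) (g q) :=
  (continuous_contTime d).measurable.comp (hf.prodMk hg)

theorem measurable_contPayoff (d : Die k) :
    Measurable fun q : (Fin k → ℝ) × (Fin k → ℝ) => contPayoff d q.1 q.2 := by
  have h1 : MeasurableSet {r : ((Fin k → ℝ) × (Fin k → ℝ)) × (Fin k → ℝ) |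
      contTime d r.1.1 r.2 < contTime d r.1.2 r.2} :=
    measurableSet_lt (by fun_prop) (by fun_prop)
  have h2 : MeasurableSet {r : ((Fin k → ℝ) × (Fin k → ℝ)) × (Fin k → ℝ) |
      contTime d r.1.2 r.2 < contTime d r.1.1 r.2} :=
    measurableSet_lt (by fun_prop) (by fun_prop)
  exact ((measurable_measure_prodMk_left (ν := normals k) h1).ennreal_toReal.sub
    (measurable_measure_prodMk_left (ν := normals k) h2).ennreal_toReal).div_const 2

theorem contPayoff_neg (d : Die k) (x y : Fin k → ℝ) :
    contPayoff d y x = -contPayoff d x y := by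
  simp only [contPayoff]
  ring

theorem contPayoff_self (d : Die k) (x : Fin k → ℝ) : contPayoff d x x = 0 := by
  simp [contPayoff]

theorem abs_contPayoff_le (d : Die k) (x y : Fin k → ℝ) : |contPayoff d x y| ≤ 1 / 2 := by
  unfold contPayoff
  set a := (normals k).real {z | contTime d x z < contTime d y z} with ha
  set b := (normals k).real {z | contTime d y z < contTime d x z} with hb
  have h1 : a ≤ 1 := measureReal_le_one
  have h2 : b ≤ 1 := measureReal_le_one
  have h3 : 0 ≤ a := measureReal_nonneg
  have h4 : 0 ≤ b := measureReal_nonneg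
  rw [abs_le]
  constructor <;> linarith

/-- The payoff as the expectation of a sign. -/
theorem contPayoff_eq_integral_sign (d : Die k) (x y : Fin k → ℝ) :
    contPayoff d x y = (∫ z, Real.sign (contTime d y z - contTime d x z) ∂normals k) / 2 := by
  have h1 : MeasurableSet {z | contTime d x z < contTime d y z} :=
    measurableSet_lt (by fun_prop) (by fun_prop)
  have h2 : MeasurableSet {z | contTime d y z < contTime d x z} :=
    measurableSet_lt (by fun_prop) (by fun_prop)
  have h : ∀ z, Real.sign (contTime d y z - contTime d x z) =
      {z | contTime d x z < contTime d y z}.indicator 1 z -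
      {z | contTime d y z < contTime d x z}.indicator 1 z := by
    intro z
    rcases lt_trichotomy (contTime d x z) (contTime d y z) with h | h | h
    · simp [Real.sign_of_pos (sub_pos.2 h), h, h.le]
    · simp [h]
    · simp [Real.sign_of_neg (sub_neg.2 h), h, h.le]
  simp_rw [h]
  rw [integral_sub, integral_indicator_one h1, integral_indicator_one h2, contPayoff]
  · exact (integrable_const (1 : ℝ)).indicator h1
  · exact (integrable_const (1 : ℝ)).indicator h2

theorem measurable_sign : Measurable Real.sign := by
  unfold Real.sign
  exact Measurable.ite measurableSet_Iio measurable_const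
    (Measurable.ite measurableSet_Ioi measurable_const measurable_const)

theorem abs_sign_le_one (r : ℝ) : |Real.sign r| ≤ 1 := by
  rcases Real.sign_apply_eq r with h | h | h <;> simp [h]

theorem integrable_contPayoff_left (d : Die k) (α : ProbabilityMeasure (Fin k → ℝ))
    (y : Fin k → ℝ) : Integrable (fun x => contPayoff d x y) (α : Measure (Fin k → ℝ)) :=
  .of_bound ((measurable_contPayoff d).comp
    (measurable_id.prodMk measurable_const)).aestronglyMeasurable (1 / 2) (ae_of_all _ fun x => abs_contPayoff_le d x y)

theorem integrable_contPayoff_prod (d : Die k) (α β : ProbabilityMeasure (Fin k → ℝ)) :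
    Integrable (fun q : (Fin k → ℝ) × (Fin k → ℝ) => contPayoff d q.1 q.2)
      ((α : Measure (Fin k → ℝ)).prod (β : Measure (Fin k → ℝ))) :=
  .of_bound (measurable_contPayoff d).aestronglyMeasurable
    (1 / 2) (ae_of_all _ fun q => abs_contPayoff_le d q.1 q.2)

theorem contMixedPayoff_neg (d : Die k) (α β : ProbabilityMeasure (Fin k → ℝ)) :
    contMixedPayoff d β α = -contMixedPayoff d α β := by
  unfold contMixedPayoff
  rw [integral_integral_swap (f := fun y x => contPayoff d x y)
    (integrable_contPayoff_prod d β α).swap, ← integral_neg]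
  congr 1 with x
  rw [← integral_neg]
  congr 1 with y
  exact contPayoff_neg d y x

theorem contMixedPayoff_self (d : Die k) (α : ProbabilityMeasure (Fin k → ℝ)) :
    contMixedPayoff d α α = 0 := by
  linarith [contMixedPayoff_neg d α α]

/-- A mixed strategy is optimal as soon as it does not lose against any allocation. -/
theorem isOptimal_of_forall_integral_nonneg (d : Die k) {α : ProbabilityMeasure (Fin k → ℝ)}
    (hα : IsContStrategy α)
    (h : ∀ y : Fin k → ℝ, ∑ i, y i = 0 →
      0 ≤ ∫ x, contPayoff d x y ∂(α : Measure (Fin k → ℝ))) :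
    IsOptimal d α := by
  refine ⟨hα, fun β hβ => ?_⟩
  rw [contMixedPayoff_neg, not_lt, neg_nonpos]
  refine integral_nonneg_of_ae ?_
  filter_upwards [hβ] with y hy using h y hy

/-- By antisymmetry a strategy earns `0` against itself, which bounds each of the two values on one
side; playing `α` bounds it on the other. -/
theorem hasValue_zero_of_isOptimal (d : Die k) {α : ProbabilityMeasure (Fin k → ℝ)}
    (hα : IsOptimal d α) : HasValue d 0 := by
  have h1 : ∀ β : ContStrategy k, contMixedPayoff d β.1 α ≤ 0 :=
    fun β => not_lt.1 (hα.2 β.1 β.2)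
  have h2 : ∀ β : ContStrategy k, 0 ≤ contMixedPayoff d α β.1 := fun β => by
    rw [contMixedPayoff_neg]
    linarith [h1 β]
  have h0 : ∀ β : ContStrategy k, ((contMixedPayoff d β.1 β.1 : ℝ) : EReal) = ((0 : ℝ) : EReal) :=
    fun β => by rw [contMixedPayoff_self]
  constructor
  · refine le_antisymm (iSup_le fun β => (iInf_le _ β).trans (h0 β).le) ?_
    exact le_iSup_of_le ⟨α, hα.1⟩ (le_iInf fun β => EReal.coe_le_coe_iff.2 (h2 β))
  · refine le_antisymm ?_ (le_iInf fun β => le_iSup_of_le β (h0 β).ge)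
    exact iInf_le_of_le ⟨α, hα.1⟩ (iSup_le fun β => EReal.coe_le_coe_iff.2 (h1 β))

/-! ### Ties -/

theorem normals_coord_indep {i j : Fin k} (hij : i ≠ j) :
    (normals k).map (fun z => (z i, z j)) = (gaussianReal 0 1).prod (gaussianReal 0 1) := by
  have h := (iIndepFun_pi (μ := fun _ : Fin k => gaussianReal 0 1) (X := fun _ => id)
    (fun _ => aemeasurable_id)).indepFun hij
  have h' := (indepFun_iff_map_prod_eq_prod_map_map (measurable_pi_apply i).aemeasurable
    (measurable_pi_apply j).aemeasurable).1 h
  have hm : ∀ l : Fin k, Measure.map (fun z : Fin k → ℝ => z l)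
      (Measure.pi fun _ : Fin k => gaussianReal 0 1) = gaussianReal 0 1 := fun l =>
    (measurePreserving_eval (fun _ : Fin k => gaussianReal 0 1) l).map_eq
  simpa [hm, normals] using h'

/-- Given one coordinate, the equation confines the other, independent one to a single point, and
the Gaussian has no atoms. -/
theorem normals_ae_ne (d : Die k) {i j : Fin k} (hij : i ≠ j) (a b : ℝ) :
    ∀ᵐ z ∂normals k, a + z i / √(d.prob i) ≠ b + z j / √(d.prob j) := by
  have hs : MeasurableSet {q : ℝ × ℝ | a + q.1 / √(d.prob i) = b + q.2 / √(d.prob j)} :=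
    measurableSet_eq_fun (by fun_prop) (by fun_prop)
  have h0 : ((gaussianReal 0 1).prod (gaussianReal 0 1))
      {q : ℝ × ℝ | a + q.1 / √(d.prob i) = b + q.2 / √(d.prob j)} = 0 := by
    rw [Measure.measure_prod_null hs]
    have : NullSingletonClass (gaussianReal 0 1) := nullSingletonClass_gaussianReal one_ne_zero
    refine ae_of_all _ fun u => measure_mono_null (t := {√(d.prob j) * (a + u / √(d.prob i) - b)})
      (fun v hv => ?_) (measure_singleton _)
    have hj := (d.sqrt_prob_pos j).ne'
    simp only [Set.mem_preimage, Set.mem_ofPred_eq] at hv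
    rw [Set.mem_singleton_iff, hv]
    field_simp
    ring
  rw [← normals_coord_indep hij, Measure.map_apply (by fun_prop) hs] at h0
  rw [ae_iff]
  simpa using h0

/-- Almost surely, a tie can only be caused by a bin in which both players have the same number of
tokens, and in which both are the last. -/
theorem ae_tie (d : Die k) (x y : Fin k → ℝ) :
    ∀ᵐ z ∂normals k, contTime d x z = contTime d y z →
      ∃ i, x i = y i ∧ contTime d y z = y i / d.prob i + z i / √(d.prob i) ∧
        ∀ l, l ≠ i → y l / d.prob l + z l / √(d.prob l) < contTime d y z := by
  -- Different bins of the two players almost surely finish at different times, so at a tie every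
  -- last bin of one player is the last bin of the other.
  have h : ∀ᵐ z ∂normals k, ∀ i j, i ≠ j →
      x i / d.prob i + z i / √(d.prob i) ≠ y j / d.prob j + z j / √(d.prob j) := by
    simp only [ae_all_iff]
    exact fun i j hij => normals_ae_ne d hij _ _
  filter_upwards [h] with z hz hxy
  obtain ⟨i, hi⟩ := exists_eq_contTime d x z
  obtain ⟨j, hj⟩ := exists_eq_contTime d y z
  have hij : i = j := by
    by_contra hne
    exact hz i j hne (by rw [hi, hj, hxy])
  subst hij
  refine ⟨i, ?_, hj.symm, fun l hl => lt_of_le_of_ne (le_contTime d y z l) fun hl' => ?_⟩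
  · rw [hxy, ← hj, add_left_inj, div_left_inj' (d.prob_pos i).ne'] at hi
    exact hi
  · exact hz i l hl.symm (by rw [hi, hl', hxy])

/-! ### Optimality from loss probabilities -/

/-- The probability that the allocation `y` beats the mixed strategy `α`. -/
noncomputable def lossProb (d : Die k) (α : ProbabilityMeasure (Fin k → ℝ)) (y : Fin k → ℝ) : ℝ :=
  ((α : Measure (Fin k → ℝ)).prod (normals k)).real
    {q | contTime d y q.2 < contTime d q.1 q.2}

theorem measurableSet_loss (d : Die k) (y : Fin k → ℝ) :
    MeasurableSet {q : (Fin k → ℝ) × (Fin k → ℝ) | contTime d y q.2 < contTime d q.1 q.2} :=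
  measurableSet_lt (by fun_prop) (by fun_prop)

theorem lossProb_eq_integral (d : Die k) (α : ProbabilityMeasure (Fin k → ℝ)) (y : Fin k → ℝ) :
    lossProb d α y = ∫ x, (normals k).real {z | contTime d y z < contTime d x z}
      ∂(α : Measure (Fin k → ℝ)) := by
  have hm := measurable_measure_prodMk_left (ν := normals k) (measurableSet_loss d y)
  unfold lossProb
  rw [measureReal_def, Measure.prod_apply (measurableSet_loss d y)]
  exact (integral_toReal hm.aemeasurable (ae_of_all _ fun x => measure_lt_top _ _)).symm

theorem integrable_loss (d : Die k) (α : ProbabilityMeasure (Fin k → ℝ)) (y : Fin k → ℝ) :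
    Integrable (fun x => (normals k).real {z | contTime d y z < contTime d x z})
      (α : Measure (Fin k → ℝ)) := by
  have hm := measurable_measure_prodMk_left (ν := normals k) (measurableSet_loss d y)
  refine .of_bound hm.ennreal_toReal.aestronglyMeasurable 1 (ae_of_all _ fun x => ?_)
  rw [Real.norm_of_nonneg measureReal_nonneg]
  exact measureReal_le_one

theorem contPayoff_eq_of_ne (d : Die k) {x y : Fin k → ℝ} (h : ∀ i, x i ≠ y i) :
    contPayoff d x y = 1 / 2 - (normals k).real {z | contTime d y z < contTime d x z} := by
  have h1 : (normals k).real {z | contTime d x z < contTime d y z} =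
      (normals k).real {z | contTime d y z < contTime d x z}ᶜ := by
    refine measureReal_congr ?_
    filter_upwards [ae_tie d x y] with z hz
    refine propext (lt_iff_le_and_ne.trans ?_)
    refine ⟨fun h' => not_lt.2 h'.1, fun h' => ⟨not_lt.1 h', fun he => ?_⟩⟩
    obtain ⟨i, hi, -⟩ := hz he
    exact h i hi
  rw [contPayoff, h1, probReal_compl_eq_one_sub (measurableSet_lt (by fun_prop) (by fun_prop))]
  ring

theorem integral_contPayoff_eq_of_generic (d : Die k) {α : ProbabilityMeasure (Fin k → ℝ)}
    {y : Fin k → ℝ} (h : ∀ i, (α : Measure (Fin k → ℝ)) {x | x i = y i} = 0) :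
    ∫ x, contPayoff d x y ∂(α : Measure (Fin k → ℝ)) = 1 / 2 - lossProb d α y := by
  have hae : ∀ᵐ x ∂(α : Measure (Fin k → ℝ)), ∀ i, x i ≠ y i := by
    rw [ae_all_iff]
    intro i
    rw [ae_iff]
    simpa using h i
  rw [lossProb_eq_integral, integral_congr_ae (hae.mono fun x hx => contPayoff_eq_of_ne d hx),
    integral_sub (integrable_const _) (integrable_loss d α y)]
  simp

/-- Moving an allocation by opposite small amounts cancels the effect of breaking the ties. -/
theorem tendsto_sign_add_sign (d : Die k) {x y w z : Fin k → ℝ}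
    (hz : contTime d x z = contTime d y z →
      ∃ i, x i = y i ∧ contTime d y z = y i / d.prob i + z i / √(d.prob i) ∧
        ∀ l, l ≠ i → y l / d.prob l + z l / √(d.prob l) < contTime d y z) :
    Tendsto (fun e : ℝ => Real.sign (contTime d (y + e • w) z - contTime d x z) +
      Real.sign (contTime d (y - e • w) z - contTime d x z)) (𝓝 0)
      (𝓝 (2 * Real.sign (contTime d y z - contTime d x z))) := by
  have hp : Tendsto (fun e : ℝ => contTime d (y + e • w) z) (𝓝 0) (𝓝 (contTime d y z)) := by
    have : Continuous fun e : ℝ => contTime d (y + e • w) z := by fun_prop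
    simpa using this.tendsto 0
  have hm : Tendsto (fun e : ℝ => contTime d (y - e • w) z) (𝓝 0) (𝓝 (contTime d y z)) := by
    have : Continuous fun e : ℝ => contTime d (y - e • w) z := by fun_prop
    simpa using this.tendsto 0
  refine tendsto_const_nhds.congr' ?_
  rcases lt_trichotomy (contTime d x z) (contTime d y z) with h | h | h
  · filter_upwards [hp.eventually_const_lt h, hm.eventually_const_lt h] with e h1 h2
    rw [Real.sign_of_pos (sub_pos.2 h), Real.sign_of_pos (sub_pos.2 h1),
      Real.sign_of_pos (sub_pos.2 h2)]
    norm_num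
  · obtain ⟨i, -, hi, hl⟩ := hz h
    -- For small `e` the bin `i` alone decides the time of `y + e • v`, so the time is affine in
    -- `e`. The slopes along `w` and `-w` are opposite, and the two signs cancel exactly.
    have key : ∀ v : Fin k → ℝ, Tendsto (fun e : ℝ => contTime d (y + e • v) z) (𝓝 0)
        (𝓝 (contTime d y z)) →
        ∀ᶠ e in 𝓝 (0 : ℝ), contTime d (y + e • v) z - contTime d x z = e * (v i / d.prob i) := by
      intro v hv
      have hi' : Tendsto (fun e : ℝ => (y + e • v) i / d.prob i + z i / √(d.prob i)) (𝓝 0)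
          (𝓝 (contTime d y z)) := by
        have : Continuous fun e : ℝ => (y + e • v) i / d.prob i + z i / √(d.prob i) := by fun_prop
        simpa [hi] using this.tendsto 0
      have hlt : ∀ᶠ e in 𝓝 (0 : ℝ), ∀ l, l ≠ i → (y + e • v) l / d.prob l + z l / √(d.prob l) <
          (y + e • v) i / d.prob i + z i / √(d.prob i) := by
        refine eventually_all.2 fun l => ?_
        by_cases hli : l = i
        · simp [hli]
        · have hl' : Tendsto (fun e : ℝ => (y + e • v) l / d.prob l + z l / √(d.prob l)) (𝓝 0)
              (𝓝 (y l / d.prob l + z l / √(d.prob l))) := by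
            have : Continuous fun e : ℝ => (y + e • v) l / d.prob l + z l / √(d.prob l) := by
              fun_prop
            simpa using this.tendsto 0
          filter_upwards [hl'.eventually_lt hi' (hl l hli)] with e he _ using he
      filter_upwards [hlt] with e he
      obtain ⟨j, hj⟩ := exists_eq_contTime d (y + e • v) z
      have hji : j = i := by
        by_contra hne
        exact absurd (he j hne) (not_lt.2 (hj ▸ le_contTime d (y + e • v) z i))
      subst hji
      rw [← hj, h, hi]
      simp only [Pi.add_apply, Pi.smul_apply, smul_eq_mul]
      ring
    have hm' : Tendsto (fun e : ℝ => contTime d (y + e • (-w)) z) (𝓝 0) (𝓝 (contTime d y z)) := by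
      simpa [sub_eq_add_neg] using hm
    filter_upwards [key w hp, key (-w) hm'] with e h1 h2
    rw [smul_neg, ← sub_eq_add_neg] at h2
    rw [h1, h2, h, sub_self, Real.sign_zero, mul_zero, Pi.neg_apply, neg_div, mul_neg,
      Real.sign_neg, add_neg_cancel]
  · filter_upwards [hp.eventually_lt_const h, hm.eventually_lt_const h] with e h1 h2
    rw [Real.sign_of_neg (sub_neg.2 h), Real.sign_of_neg (sub_neg.2 h1),
      Real.sign_of_neg (sub_neg.2 h2)]
    norm_num

theorem tendsto_contPayoff_add_contPayoff (d : Die k) (x y w : Fin k → ℝ)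
    {e : ℕ → ℝ} (he : Tendsto e atTop (𝓝 0)) :
    Tendsto (fun n => contPayoff d x (y + e n • w) + contPayoff d x (y - e n • w)) atTop
      (𝓝 (2 * contPayoff d x y)) := by
  have hint : ∀ v : Fin k → ℝ,
      Integrable (fun z => Real.sign (contTime d v z - contTime d x z)) (normals k) := fun v =>
    .of_bound (measurable_sign.comp (by fun_prop)).aestronglyMeasurable 1
      (ae_of_all _ fun z => abs_sign_le_one _)
  have h : Tendsto (fun n => ∫ z, (Real.sign (contTime d (y + e n • w) z - contTime d x z) +
      Real.sign (contTime d (y - e n • w) z - contTime d x z)) ∂normals k) atTop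
      (𝓝 (∫ z, 2 * Real.sign (contTime d y z - contTime d x z) ∂normals k)) := by
    refine tendsto_integral_of_dominated_convergence (fun _ => 2)
      (fun n => ((hint _).add (hint _)).aestronglyMeasurable) (integrable_const _)
      (fun n => ae_of_all _ fun z => ?_) ?_
    · refine (norm_add_le _ _).trans ?_
      have h1 := abs_sign_le_one (contTime d (y + e n • w) z - contTime d x z)
      have h2 := abs_sign_le_one (contTime d (y - e n • w) z - contTime d x z)
      simp only [Real.norm_eq_abs]
      linarith
    · filter_upwards [ae_tie d x y] with z hz using (tendsto_sign_add_sign d hz).comp he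
  convert! h.div_const 2 using 2
  · rw [contPayoff_eq_integral_sign, contPayoff_eq_integral_sign, integral_add (hint _) (hint _)]
    ring
  · rw [contPayoff_eq_integral_sign, integral_const_mul]
    ring

theorem tendsto_integral_contPayoff_add (d : Die k) (α : ProbabilityMeasure (Fin k → ℝ))
    (y w : Fin k → ℝ) {e : ℕ → ℝ} (he : Tendsto e atTop (𝓝 0)) :
    Tendsto (fun n => ∫ x, contPayoff d x (y + e n • w) ∂(α : Measure (Fin k → ℝ)) +
        ∫ x, contPayoff d x (y - e n • w) ∂(α : Measure (Fin k → ℝ))) atTop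
      (𝓝 (2 * ∫ x, contPayoff d x y ∂(α : Measure (Fin k → ℝ)))) := by
  have hint := integrable_contPayoff_left d α
  rw [← integral_const_mul]
  simp_rw [← integral_add (hint _) (hint _)]
  refine tendsto_integral_of_dominated_convergence (fun _ => 1)
    (fun n => ((hint _).add (hint _)).aestronglyMeasurable) (integrable_const _)
    (fun n => ae_of_all _ fun x => ?_)
    (ae_of_all _ fun x => tendsto_contPayoff_add_contPayoff d x y w he)
  refine (norm_add_le _ _).trans ?_
  have h1 := abs_contPayoff_le d x (y + e n • w)
  have h2 := abs_contPayoff_le d x (y - e n • w)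
  simp only [Real.norm_eq_abs]
  linarith

/-- There are arbitrarily small `e` such that `y + e w` and `y - e w` differ almost surely in each
coordinate from a random vector. -/
theorem exists_generic (α : ProbabilityMeasure (Fin k → ℝ)) (y : Fin k → ℝ) {w : Fin k → ℝ}
    (hw : ∀ i, w i ≠ 0) {r : ℝ} (hr : 0 < r) :
    ∃ e ∈ Set.Ioo 0 r, (∀ i, (α : Measure (Fin k → ℝ)) {x | x i = (y + e • w) i} = 0) ∧
      ∀ i, (α : Measure (Fin k → ℝ)) {x | x i = (y - e • w) i} = 0 := by
  have hc : ∀ v : Fin k → ℝ, (∀ i, v i ≠ 0) → {e : ℝ | ∃ i,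
      (α : Measure (Fin k → ℝ)) {x | x i = (y + e • v) i} ≠ 0}.Countable := by
    intro v hv
    -- The bad values of `e` for coordinate `i` are atoms of the law of `(x i - y i) / v i`, of
    -- which there are countably many; the good values are therefore dense.
    have h : ∀ i, {e : ℝ | 0 < (α : Measure (Fin k → ℝ)) {x | (x i - y i) / v i = e}}.Countable :=
      fun i => Measure.countable_meas_level_set_pos (by fun_prop)
    refine (Set.countable_iUnion h).mono ?_
    rintro e ⟨i, hi⟩
    refine Set.mem_iUnion.2 ⟨i, ?_⟩
    rw [Set.mem_ofPred_eq, pos_iff_ne_zero]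
    convert! hi using 3
    ext x
    have := hv i
    simp only [Pi.add_apply, Pi.smul_apply, smul_eq_mul]
    rw [div_eq_iff this, sub_eq_iff_eq_add']
  obtain ⟨e, he, her⟩ := (((hc w hw).union
    (hc (-w) fun i => neg_ne_zero.2 (hw i))).dense_compl ℝ).exists_between hr
  simp only [Set.compl_union, Set.mem_inter_iff, Set.mem_compl_iff, Set.mem_ofPred_eq, not_exists,
    not_not] at he
  refine ⟨e, her, he.1, fun i => ?_⟩
  have := he.2 i
  rwa [smul_neg, ← sub_eq_add_neg] at this

/-- Such a direction moves every coordinate while keeping the sum; it does not exist for one bin,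
where the only allocation is `0`. -/
theorem exists_ne_zero_sum_eq_zero (hk : 2 ≤ k) :
    ∃ w : Fin k → ℝ, (∀ i, w i ≠ 0) ∧ ∑ i, w i = 0 := by
  obtain ⟨m, rfl⟩ : ∃ m, k = m + 2 := ⟨k - 2, by omega⟩
  refine ⟨Fin.cons (-((m : ℝ) + 1)) fun _ => 1, fun i => ?_, ?_⟩
  · refine Fin.cases ?_ (fun j => ?_) i
    · simp only [Fin.cons_zero]
      exact neg_ne_zero.2 (by positivity)
    · simp
  · simp [Fin.sum_univ_succ]

/-- A mixed strategy that no allocation beats with probability more than one half is optimal. -/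
theorem isOptimal_of_lossProb_le (d : Die k) {α : ProbabilityMeasure (Fin k → ℝ)}
    (hα : IsContStrategy α) (h : ∀ y : Fin k → ℝ, ∑ i, y i = 0 → lossProb d α y ≤ 1 / 2) :
    IsOptimal d α := by
  refine isOptimal_of_forall_integral_nonneg d hα fun y hy => ?_
  have := d.nonempty
  rcases Nat.lt_or_ge k 2 with hk | hk
  · have hs : Subsingleton (Fin k) := Fin.subsingleton_iff_le_one.2 (by omega)
    refine integral_nonneg_of_ae ?_
    filter_upwards [hα] with x hx
    have hxy : x = y := by
      ext i
      have := Fintype.sum_subsingleton x i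
      have := Fintype.sum_subsingleton y i
      linarith
    simp [hxy, contPayoff_self]
  · obtain ⟨w, hw, hw0⟩ := exists_ne_zero_sum_eq_zero hk
    -- At generic points the hypothesis on `lossProb` says that the payoff is nonnegative; in the
    -- limit the sum of the two payoffs is twice the payoff at `y`.
    choose e he1 he2 he3 using fun n : ℕ =>
      exists_generic α y hw (r := 1 / ((n : ℝ) + 1)) (by positivity)
    have he : Tendsto e atTop (𝓝 0) :=
      squeeze_zero (fun n => (he1 n).1.le) (fun n => (he1 n).2.le)
        tendsto_one_div_add_atTop_nhds_zero_nat
    have hlim := tendsto_integral_contPayoff_add d α y w he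
    have := ge_of_tendsto' hlim (b := 0) fun n => by
      rw [integral_contPayoff_eq_of_generic d (he2 n), integral_contPayoff_eq_of_generic d (he3 n)]
      have h1 := h (y + e n • w) (by simp [Finset.sum_add_distrib, ← Finset.mul_sum, hy, hw0])
      have h2 := h (y - e n • w) (by simp [Finset.sum_sub_distrib, ← Finset.mul_sum, hy, hw0])
      linarith
    linarith

end KnockEmDown

/-! ### Finite symmetric games -/

/-- A finite symmetric game has a mixed strategy that does not lose against any pure strategy. -/
theorem exists_stdSimplex_forall_sum_nonneg {ι : Type*} [Fintype ι] [Nonempty ι] [DecidableEq ι]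
    (A : ι → ι → ℝ) (hA : ∀ i j, A j i = -A i j) :
    ∃ p ∈ stdSimplex ℝ ι, ∀ j, 0 ≤ ∑ i, p i * A i j := by
  -- The first argument of `f` is the minimizer. With the indices of `A` exchanged, `f a (Pi.single
  -- j 1) ≤ 0` says that `a` does not lose against `j`.
  let f : (ι → ℝ) →ₗ[ℝ] (ι → ℝ) →ₗ[ℝ] ℝ := Matrix.toLinearMap₂' ℝ (Matrix.of fun i j => A j i)
  have hf : ∀ x y, f x y = ∑ i, ∑ j, x i * (y j * A j i) := fun x y => by
    simp [f, Matrix.toLinearMap₂'_apply]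
  have hne : (stdSimplex ℝ ι).Nonempty := ⟨_, single_mem_stdSimplex ℝ (Classical.arbitrary ι)⟩
  have hc := convex_stdSimplex ℝ ι
  obtain ⟨a, ha, b, hb, hab⟩ := Sion.exists_isSaddlePointOn (f := fun x y => f x y) hne hc
    (isCompact_stdSimplex ℝ ι)
    (fun y _ =>
      (LinearMap.continuous_of_finiteDimensional (f.flip y)).continuousOn.lowerSemicontinuousOn)
    (fun y _ => ((f.flip y).convexOn hc).quasiconvexOn) hc hne (isCompact_stdSimplex ℝ ι)
    (fun x _ =>
      (LinearMap.continuous_of_finiteDimensional (f x)).continuousOn.upperSemicontinuousOn)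
    (fun x _ => ((f x).concaveOn hc).quasiconcaveOn)
  have hbb : f b b = 0 := by
    have : f b b = -f b b := by
      conv_lhs => rw [hf, Finset.sum_comm]
      rw [hf]
      simp_rw [← Finset.sum_neg_distrib]
      refine Finset.sum_congr rfl fun i _ => Finset.sum_congr rfl fun j _ => ?_
      rw [hA j i]
      ring
    linarith
  refine ⟨a, ha, fun j => ?_⟩
  -- The saddle inequality gives `f a (Pi.single j 1) ≤ f b b`, and an antisymmetric form vanishes
  -- on the diagonal.
  have h := hab b hb (Pi.single j 1) (single_mem_stdSimplex ℝ j)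
  simp only [hbb, hf] at h
  have h' : ∀ i, ∑ l, a i * ((Pi.single j 1 : ι → ℝ) l * A l i) = -(a i * A i j) := fun i => by
    rw [Finset.sum_eq_single j]
    · rw [Pi.single_eq_same, hA i j]
      ring
    · intro l _ hl
      simp [Pi.single_eq_of_ne hl]
    · simp
  simp_rw [h', Finset.sum_neg_distrib] at h
  linarith

/-! ### Existence of an optimal strategy: bounded supports and compactness -/

namespace KnockEmDown

variable {k : ℕ}

/-- Ties can only make this strict. Unlike `contPayoff_eq_of_ne`, it needs no genericity, which
suffices to bound `lossProb` from above. -/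
theorem contPayoff_le (d : Die k) (x y : Fin k → ℝ) :
    contPayoff d x y ≤ 1 / 2 - (normals k).real {z | contTime d y z < contTime d x z} := by
  have h1 : (normals k).real {z | contTime d x z < contTime d y z} ≤
      (normals k).real {z | contTime d y z < contTime d x z}ᶜ :=
    by
    refine measureReal_mono fun z hz => ?_
    simpa using le_of_lt hz
  rw [probReal_compl_eq_one_sub (measurableSet_lt (by fun_prop) (by fun_prop))] at h1
  rw [contPayoff]
  linarith

theorem integral_contPayoff_le (d : Die k) (α : ProbabilityMeasure (Fin k → ℝ)) (y : Fin k → ℝ) :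
    ∫ x, contPayoff d x y ∂(α : Measure (Fin k → ℝ)) ≤ 1 / 2 - lossProb d α y := by
  have h := integral_mono (integrable_contPayoff_left d α y)
    ((integrable_const (1 / 2)).sub (integrable_loss d α y)) fun x => contPayoff_le d x y
  refine h.trans_eq ?_
  rw [lossProb_eq_integral]
  exact (integral_sub (integrable_const _) (integrable_loss d α y)).trans (by simp)

instance : (normals k).IsOpenPosMeasure := by
  have : (gaussianReal 0 1).IsOpenPosMeasure :=
    (gaussianReal_absolutelyContinuous' 0 one_ne_zero).isOpenPosMeasure
  unfold normals
  infer_instance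

/-- The allocation `0` beats each allocation with a probability that is bounded below. -/
theorem exists_contPayoff_zero_le (d : Die k) :
    ∃ c : ℝ, 0 < c ∧ c ≤ 1 / 2 ∧ ∀ x : Fin k → ℝ, ∑ i, x i = 0 → contPayoff d x 0 ≤ 1 / 2 - c := by
  have := d.nonempty
  -- On `E i` the bin `i` is the last one under allocation `0`. A nonzero `x` of sum zero has a
  -- coordinate `x i > 0`, and then `0` beats `x` on `E i`.
  let E : Fin k → Set (Fin k → ℝ) := fun i =>
    {z | ∀ j, j ≠ i → z j / √(d.prob j) < z i / √(d.prob i)}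
  have hpos : ∀ i, 0 < (normals k).real (E i) := by
    intro i
    have ho : IsOpen (E i) := by
      have : E i = ⋂ j, ⋂ _ : j ≠ i, {z | z j / √(d.prob j) < z i / √(d.prob i)} := by
        ext z
        simp [E]
      rw [this]
      refine isOpen_iInter_of_finite fun j => isOpen_iInter_of_finite fun _ => ?_
      exact isOpen_lt (by fun_prop) (by fun_prop)
    have hn : (E i).Nonempty := ⟨Pi.single i 1, fun j hj => by
      simpa [Pi.single_eq_of_ne hj] using d.prob_pos i⟩
    exact ENNReal.toReal_pos (ho.measure_pos _ hn).ne' (measure_ne_top _ _)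
  obtain ⟨i₀, hi₀⟩ := Finite.exists_min fun i => (normals k).real (E i)
  -- The cap `1 / 2` takes care of `x = 0`, where the payoff is `0`.
  refine ⟨min ((normals k).real (E i₀)) (1 / 2), lt_min (hpos i₀) (by norm_num),
    min_le_right _ _, fun x hx => ?_⟩
  by_cases h0 : x = 0
  · rw [h0, contPayoff_self]
    linarith [min_le_right ((normals k).real (E i₀)) (1 / 2)]
  · obtain ⟨j, hj⟩ := Function.ne_iff.1 h0
    obtain ⟨i, -, hi⟩ := Finset.exists_pos_of_sum_zero_of_exists_nonzero x hx
      ⟨j, Finset.mem_univ _, hj⟩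
    have hsub : (normals k).real (E i) ≤
        (normals k).real {z | contTime d 0 z < contTime d x z} := by
      refine measureReal_mono fun z hz => (contTime_lt_iff d).2 fun l => ?_
      have h1 : z l / √(d.prob l) ≤ z i / √(d.prob i) := by
        by_cases hl : l = i
        · rw [hl]
        · exact (hz l hl).le
      have h2 := le_contTime d x z i
      have h3 : 0 < x i / d.prob i := div_pos hi (d.prob_pos i)
      simp only [Pi.zero_apply, zero_div, zero_add]
      linarith
    have := contPayoff_le d x 0
    linarith [hi₀ i, min_le_left ((normals k).real (E i₀)) (1 / 2)]

/-- The largest coordinate works: since the sum is zero, a negative coordinate is compensated by the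
other `k - 1`, each at most the maximum. -/
theorem exists_norm_le_mul (d : Die k) {y : Fin k → ℝ} (hy : ∑ i, y i = 0) :
    ∃ i, ‖y‖ ≤ k * y i := by
  have := d.nonempty
  obtain ⟨i, hi⟩ := Finite.exists_max y
  have hk : (1 : ℝ) ≤ k := by
    exact_mod_cast Fin.pos_iff_nonempty.2 this
  have h0 : 0 ≤ y i := by
    have : ∑ j, y j ≤ ∑ _j : Fin k, y i := Finset.sum_le_sum fun j _ => hi j
    rw [hy, Finset.sum_const, Finset.card_univ, Fintype.card_fin, nsmul_eq_mul] at this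
    exact nonneg_of_mul_nonneg_right this (by linarith)
  refine ⟨i, (pi_norm_le_iff_of_nonneg (by positivity)).2 fun j => ?_⟩
  rw [Real.norm_eq_abs, abs_le]
  constructor
  · have h1 : ∑ l ∈ Finset.univ.erase j, y l ≤ ∑ _l ∈ Finset.univ.erase j, y i :=
      Finset.sum_le_sum fun l _ => hi l
    have h2 := Finset.add_sum_erase Finset.univ y (Finset.mem_univ j)
    rw [Finset.sum_const, Finset.card_erase_of_mem (Finset.mem_univ _), Finset.card_univ,
      Fintype.card_fin, nsmul_eq_mul, Nat.cast_sub (by exact_mod_cast hk), Nat.cast_one] at h1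
    nlinarith
  · nlinarith [hi j]

/-- Bounded allocations beat the ones that are far enough from `0`, with probability near `1`. -/
theorem exists_forall_le_contPayoff (d : Die k) {ε : ℝ} (hε : 0 < ε) (R : ℝ) :
    ∃ R' : ℝ, ∀ x y : Fin k → ℝ, ‖x‖ ≤ R → ∑ i, y i = 0 → R' < ‖y‖ →
      1 / 2 - ε ≤ contPayoff d x y := by
  have := d.nonempty
  obtain ⟨B, hB, hBε⟩ := isTightMeasureSet_iff_exists_isCompact_measure_compl_le.1
    (isTightMeasureSet_singleton (μ := normals k)) (ENNReal.ofReal ε) (by simpa using hε)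
  obtain ⟨M, hM⟩ := hB.isBounded.subset_closedBall 0
  let C : ℝ := ∑ i, (1 / d.prob i + 1 / √(d.prob i))
  have hC : ∀ i, 1 / d.prob i + 1 / √(d.prob i) ≤ C := fun i =>
    Finset.single_le_sum (f := fun i => 1 / d.prob i + 1 / √(d.prob i))
      (fun i _ => by have := d.prob_pos i; positivity) (Finset.mem_univ i)
  have hk : (1 : ℝ) ≤ k := by
    exact_mod_cast Fin.pos_iff_nonempty.2 this
  -- On `B` the time of `x` is at most `(|R| + |M|) C`. The largest coordinate of `y` exceeds `|R| C
  -- + 2 |M| C`, and the noise takes at most `|M| C` from it.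
  refine ⟨k * (|R| * C + 2 * |M| * C), fun x y hx hy hyR => ?_⟩
  have hsub : B ⊆ {z | contTime d x z < contTime d y z} := by
    intro z hz
    have hz' : ‖z‖ ≤ |M| := (mem_closedBall_zero_iff.1 (hM hz)).trans (le_abs_self M)
    obtain ⟨i, hi⟩ := exists_norm_le_mul d hy
    have hyi : |R| * C + 2 * |M| * C < y i := by
      have := hyR.trans_le hi
      exact lt_of_mul_lt_mul_left this (by linarith)
    have hb : ∀ j, |z j / √(d.prob j)| ≤ |M| * (1 / √(d.prob j)) := fun j => by
      rw [abs_div, abs_of_pos (d.sqrt_prob_pos j), div_eq_mul_one_div]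
      have := d.sqrt_prob_pos j
      exact mul_le_mul_of_nonneg_right ((norm_le_pi_norm z j).trans hz') (by positivity)
    have hyt : |R| * C + |M| * C < contTime d y z := by
      refine lt_of_lt_of_le ?_ (le_contTime d y z i)
      have h1 : 1 / √(d.prob i) ≤ C := by
        have := d.prob_pos i
        have : 0 ≤ 1 / d.prob i := by positivity
        linarith [hC i]
      have h2 := (abs_le.1 (hb i)).1
      have h3 : |M| * (1 / √(d.prob i)) ≤ |M| * C := by gcongr
      have h4 : y i ≤ y i / d.prob i := by
        have hp1 : d.prob i ≤ 1 := by
          rw [← d.sum_prob]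
          exact Finset.single_le_sum (fun j _ => (d.prob_pos j).le) (Finset.mem_univ i)
        have hC0 : 0 ≤ C := by
          have := d.sqrt_prob_pos i
          exact le_trans (by positivity) h1
        exact le_div_self (le_trans (by positivity) hyi.le) (d.prob_pos i) hp1
      linarith
    refine (contTime_lt_iff d).2 fun j => lt_of_le_of_lt ?_ hyt
    have hp := d.prob_pos j
    have hs := d.sqrt_prob_pos j
    have hxj : x j ≤ |R| := (le_abs_self _).trans
      ((norm_le_pi_norm x j).trans (hx.trans (le_abs_self R)))
    have h1 : x j / d.prob j ≤ |R| * (1 / d.prob j) := by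
      rw [div_eq_mul_one_div]
      gcongr
    have h2 := (abs_le.1 (hb j)).2
    have h3 : |R| * (1 / d.prob j) ≤ |R| * C := by
      gcongr
      have : 0 ≤ 1 / √(d.prob j) := by positivity
      linarith [hC j]
    have h4 : |M| * (1 / √(d.prob j)) ≤ |M| * C := by
      gcongr
      have : 0 ≤ 1 / d.prob j := by positivity
      linarith [hC j]
    linarith
  have h1 : (normals k).real Bᶜ ≤ ε :=
    ENNReal.toReal_le_of_le_ofReal hε.le (hBε _ rfl)
  rw [probReal_compl_eq_one_sub hB.measurableSet] at h1
  have h2 := measureReal_mono (μ := normals k) hsub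
  have h3 := contPayoff_le d y x
  rw [contPayoff_neg] at h3
  linarith

/-- The finite restrictions of the continuous game have optimal strategies with uniformly bounded
supports. -/
theorem exists_bound_support (d : Die k) :
    ∃ R : ℝ, ∀ S : Finset (Fin k → ℝ), (∀ x ∈ S, ∑ i, x i = 0) → 0 ∈ S →
      ∃ p ∈ stdSimplex ℝ S, (∀ y : S, 0 ≤ ∑ x : S, p x * contPayoff d x.1 y.1) ∧
        ∀ x : S, p x ≠ 0 → ‖x.1‖ ≤ R := by
  classical
  obtain ⟨c, hc, hc2, hcK⟩ := exists_contPayoff_zero_le d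
  have hε : 0 < c / 2 := by linarith
  obtain ⟨R, hR⟩ := exists_forall_le_contPayoff d hε 0
  obtain ⟨R', hR'⟩ := exists_forall_le_contPayoff d hε R
  refine ⟨R', fun S hS h0 => ?_⟩
  have : Nonempty S := ⟨⟨0, h0⟩⟩
  obtain ⟨p, hp, hpA⟩ := exists_stdSimplex_forall_sum_nonneg
    (fun x y : S => contPayoff d x.1 y.1) fun x y => contPayoff_neg d x.1 y.1
  refine ⟨p, hp, hpA, fun y hy => ?_⟩
  by_contra! hyR
  -- `q` is the mass that `p` gives to the ball of radius `R`. A support point `y` outside the ball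
  -- of radius `R'` forces `q` to satisfy two incompatible bounds.
  let q : ℝ := ∑ x : S, if ‖x.1‖ ≤ R then p x else 0
  have hq : q * (1 - c / 2) ≤ 1 / 2 := by
    -- Complementary slackness: the nonnegative payoffs against pure strategies average to `0` under
    -- `p`, so each one in the support is `0`.
    have hzero : p y * ∑ x : S, p x * contPayoff d x.1 y.1 = 0 := by
      have hs : ∑ y : S, p y * ∑ x : S, p x * contPayoff d x.1 y.1 = 0 := by
        have : ∑ y : S, p y * ∑ x : S, p x * contPayoff d x.1 y.1 =
            -∑ y : S, p y * ∑ x : S, p x * contPayoff d x.1 y.1 := by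
          conv_lhs => simp only [Finset.mul_sum]
          rw [Finset.sum_comm]
          simp_rw [Finset.mul_sum, ← Finset.sum_neg_distrib]
          refine Finset.sum_congr rfl fun u _ => Finset.sum_congr rfl fun v _ => ?_
          rw [contPayoff_neg d v.1 u.1]
          ring
        linarith
      exact (Finset.sum_eq_zero_iff_of_nonneg fun y _ => mul_nonneg (hp.1 y) (hpA y)).1 hs y
        (Finset.mem_univ y)
    have hsum := (mul_eq_zero.1 hzero).resolve_left hy
    have hle : ∑ x : S, ((if ‖x.1‖ ≤ R then p x else 0) * (1 - c / 2) - p x * (1 / 2)) ≤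
        ∑ x : S, p x * contPayoff d x.1 y.1 := by
      refine Finset.sum_le_sum fun x _ => ?_
      have hpx := hp.1 x
      split_ifs with hx
      · nlinarith [hR' x.1 y.1 hx (hS y.1 y.2) hyR]
      · nlinarith [(abs_le.1 (abs_contPayoff_le d x.1 y.1)).1]
    rw [Finset.sum_sub_distrib, ← Finset.sum_mul, ← Finset.sum_mul, hp.2, hsum] at hle
    linarith
  -- Against `0`, the points in the ball earn at most `1 / 2 - c` and the others at most `-(1 / 2 -
  -- c / 2)`, while the total is nonnegative.
  have hq' : 1 / 2 - c / 2 ≤ q * (1 - c - c / 2) := by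
    have hle : ∑ x : S, p x * contPayoff d x.1 0 ≤
        ∑ x : S, ((if ‖x.1‖ ≤ R then p x else 0) * (1 - c - c / 2) - p x * (1 / 2 - c / 2)) := by
      refine Finset.sum_le_sum fun x _ => ?_
      have hpx := hp.1 x
      split_ifs with hx
      · nlinarith [hcK x.1 (hS x.1 x.2)]
      · have := hR 0 x.1 (by simp) (hS x.1 x.2) (not_le.1 hx)
        rw [contPayoff_neg] at this
        nlinarith
    rw [Finset.sum_sub_distrib, ← Finset.sum_mul, ← Finset.sum_mul, hp.2] at hle
    linarith [hpA ⟨0, h0⟩]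
  -- Together `hq` and `hq'` give `q ≤ 1 / 2`; as `1 - 3c / 2 > 0`, `hq'` then yields `1 / 2 - c / 2
  -- ≤ 1 / 2 - 3c / 4`, which is absurd.
  nlinarith

/-- A strict win is an open event in `(x, z)`, so its probability is lower semicontinuous in `α` by
the portmanteau theorem. -/
theorem isClosed_lossProb_le (d : Die k) (y : Fin k → ℝ) (c : ℝ) :
    IsClosed {α : ProbabilityMeasure (Fin k → ℝ) | lossProb d α y ≤ c} := by
  let G : Set ((Fin k → ℝ) × (Fin k → ℝ)) := {q | contTime d y q.2 < contTime d q.1 q.2}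
  have hG : IsOpen G := isOpen_lt (by fun_prop) (by fun_prop)
  have hl : LowerSemicontinuous
      fun μ : ProbabilityMeasure ((Fin k → ℝ) × (Fin k → ℝ)) => (μ : Measure _) G :=
    lowerSemicontinuous_iff_le_liminf.2 fun μ =>
      ProbabilityMeasure.le_liminf_measure_open_of_tendsto tendsto_id hG
  let γ : ProbabilityMeasure (Fin k → ℝ) := ⟨normals k, inferInstance⟩
  have hcont : Continuous fun α : ProbabilityMeasure (Fin k → ℝ) => α.prod γ := by fun_prop
  rcases lt_or_ge c 0 with hc | hc
  · convert! isClosed_empty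
    ext α
    simpa [lossProb] using hc.trans_le measureReal_nonneg
  · convert! (hl.isClosed_preimage (ENNReal.ofReal c)).preimage hcont using 1
    ext α
    exact (ENNReal.le_ofReal_iff_toReal_le (measure_ne_top _ _) hc).symm

/-- The continuous game has an optimal strategy. -/
theorem exists_isOptimal (d : Die k) : ∃ α : ProbabilityMeasure (Fin k → ℝ), IsOptimal d α := by
  classical
  obtain ⟨R, hR⟩ := exists_bound_support d
  let H : Set (Fin k → ℝ) := {x | ∑ i, x i = 0}
  have hH : IsClosed H := isClosed_eq (by fun_prop) continuous_const
  let B : Set (Fin k → ℝ) := Metric.closedBall 0 R ∩ H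
  have hB : IsCompact B := (isCompact_closedBall 0 R).inter_right hH
  -- The tightness criterion with constant compact set `B` and constant bound `0`: the measures
  -- carried by `B`.
  have hcomp : IsCompact {α : ProbabilityMeasure (Fin k → ℝ) | ∀ _ : ℕ, α Bᶜ ≤ 0} :=
    isCompact_setOfPred_probabilityMeasure_mass_eq_compl_isCompact_le tendsto_const_nhds
      (fun _ => hB) (.inl inferInstance)
  obtain ⟨α, hα, hα'⟩ := hcomp.inter_iInter_nonempty
    (fun y : H => {α : ProbabilityMeasure (Fin k → ℝ) | lossProb d α y.1 ≤ 1 / 2})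
    (fun y => isClosed_lossProb_le d y.1 _) fun u => by
      -- The point `0` is added because the uniform bound on supports comes from play against it.
      let S : Finset (Fin k → ℝ) := insert 0 (u.image Subtype.val)
      have hS : ∀ x ∈ S, ∑ i, x i = 0 := by
        intro x hx
        rcases Finset.mem_insert.1 hx with rfl | hx
        · simp
        · obtain ⟨y, -, rfl⟩ := Finset.mem_image.1 hx
          exact y.2
      obtain ⟨p, hp, hpK, hpR⟩ := hR S hS (Finset.mem_insert_self _ _)
      let μ : Measure (Fin k → ℝ) := ∑ x : S, ENNReal.ofReal (p x) • Measure.dirac x.1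
      have hμ : IsProbabilityMeasure μ := by
        constructor
        simp only [μ, Measure.coe_finsetSum, Finset.sum_apply, Measure.smul_apply,
          Measure.dirac_apply_of_mem (Set.mem_univ _), smul_eq_mul, mul_one]
        rw [← ENNReal.ofReal_sum_of_nonneg (fun x _ => hp.1 x), hp.2, ENNReal.ofReal_one]
      refine ⟨⟨μ, hμ⟩, fun _ => le_of_eq ?_, Set.mem_iInter₂.2 fun y hy => ?_⟩
      · have : μ Bᶜ = 0 := by
          simp only [μ, Measure.coe_finsetSum, Finset.sum_apply, Measure.smul_apply, smul_eq_mul]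
          refine Finset.sum_eq_zero fun x _ => ?_
          by_cases hx : p x = 0
          · simp [hx]
          · rw [Measure.dirac_apply' _ hB.measurableSet.compl, Set.indicator_of_notMem, mul_zero]
            simpa [B, H, hS x.1 x.2] using hpR x hx
        simpa using congrArg ENNReal.toNNReal this
      · have hyS : y.1 ∈ S := Finset.mem_insert_of_mem (Finset.mem_image_of_mem _ hy)
        have hsum : ∫ x, contPayoff d x y.1 ∂μ = ∑ x : S, p x * contPayoff d x.1 y.1 := by
          rw [integral_finsetSum_measure]
          · simp [integral_smul_measure, ENNReal.toReal_ofReal (hp.1 _)]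
          · exact fun x _ => (integrable_dirac (by simp)).smul_measure ENNReal.ofReal_ne_top
        have h0 := hpK ⟨y.1, hyS⟩
        have hl := integral_contPayoff_le d ⟨μ, hμ⟩ y.1
        rw [ProbabilityMeasure.coe_mk, hsum] at hl
        have : lossProb d ⟨μ, hμ⟩ y.1 ≤ 1 / 2 := by linarith
        exact this
  refine ⟨α, isOptimal_of_lossProb_le d ?_ fun y hy => Set.mem_iInter.1 hα' ⟨y, hy⟩⟩
  have h0 : (α : Measure (Fin k → ℝ)) Bᶜ = 0 := by
    rw [← ProbabilityMeasure.ennreal_coeFn_eq_coeFn_toMeasure]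
    exact_mod_cast le_antisymm (hα 0) zero_le
  have hsub : {x : Fin k → ℝ | ¬∑ i, x i = 0} ⊆ Bᶜ := fun x hx hxB => hx hxB.2
  exact measure_mono_null hsub h0

/-! ### The throws of the die -/

instance (d : Die k) : IsProbabilityMeasure d.throws := by
  unfold Die.throws
  infer_instance

theorem Die.integral_law (d : Die k) (f : Fin k → ℝ) :
    ∫ i, f i ∂d.law = ∑ i, d.prob i * f i := by
  unfold Die.law
  rw [integral_finsetSum_measure]
  · simp [ENNReal.toReal_ofReal (d.prob_pos _).le]
  · exact fun i _ => (integrable_dirac (by simp)).smul_measure ENNReal.ofReal_ne_top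

theorem Die.measurePreserving_throw (d : Die k) (s : ℕ) :
    MeasurePreserving (fun ω : ℕ → Fin k => ω s) d.throws d.law :=
  measurePreserving_eval_infinitePi (fun _ : ℕ => d.law) s

theorem Die.integral_throws (d : Die k) (f : Fin k → ℝ) (s : ℕ) :
    ∫ ω, f (ω s) ∂d.throws = ∑ i, d.prob i * f i := by
  rw [← d.integral_law, ← (d.measurePreserving_throw s).map_eq,
    integral_map (measurable_pi_apply s).aemeasurable (measurable_of_countable f).aestronglyMeasurable]

theorem Die.iIndepFun_throws (d : Die k) (f : Fin k → ℝ) :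
    iIndepFun (fun (s : ℕ) (ω : ℕ → Fin k) => f (ω s)) d.throws :=
  iIndepFun_infinitePi (P := fun _ : ℕ => d.law) (X := fun _ => f)
    fun _ => measurable_of_countable f

theorem Die.identDistrib_throws (d : Die k) (f : Fin k → ℝ) (s : ℕ) :
    IdentDistrib (fun ω : ℕ → Fin k => f (ω s)) (fun ω => f (ω 0)) d.throws d.throws := by
  have h : IdentDistrib (fun ω : ℕ → Fin k => ω s) (fun ω => ω 0) d.throws d.throws :=
    ⟨(measurable_pi_apply s).aemeasurable, (measurable_pi_apply 0).aemeasurable, by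
      rw [(d.measurePreserving_throw s).map_eq, (d.measurePreserving_throw 0).map_eq]⟩
  exact h.comp (measurable_of_countable f)

theorem Die.memLp_throws (d : Die k) (f : Fin k → ℝ) (s : ℕ) :
    MemLp (fun ω : ℕ → Fin k => f (ω s)) 2 d.throws := by
  obtain ⟨C, hC⟩ := (Set.finite_range fun i => ‖f i‖).bddAbove
  exact .of_bound ((measurable_of_countable f).comp (measurable_pi_apply s)).aestronglyMeasurable C
    (ae_of_all _ fun ω => hC ⟨ω s, rfl⟩)

theorem Die.variance_throws (d : Die k) (f : Fin k → ℝ) (s : ℕ) :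
    Var[fun ω : ℕ → Fin k => f (ω s); d.throws] =
      ∑ i, d.prob i * f i ^ 2 - (∑ i, d.prob i * f i) ^ 2 := by
  rw [variance_eq_sub (d.memLp_throws f s)]
  congr 1
  · exact d.integral_throws (fun i => f i ^ 2) s
  · rw [d.integral_throws]

theorem count_eq_sum (ω : ℕ → Fin k) (t : ℕ) (i : Fin k) :
    (count ω t i : ℝ) = ∑ s ∈ Finset.range t, (Pi.single i 1 : Fin k → ℝ) (ω s) := by
  unfold count
  rw [Finset.card_filter, Nat.cast_sum]
  refine Finset.sum_congr rfl fun s _ => ?_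
  simp [Pi.single_apply]

theorem sum_mul_count (ω : ℕ → Fin k) (t : ℕ) (u : Fin k → ℝ) :
    ∑ i, u i * (count ω t i : ℝ) = ∑ s ∈ Finset.range t, u (ω s) := by
  simp_rw [count_eq_sum, Finset.mul_sum]
  rw [Finset.sum_comm]
  refine Finset.sum_congr rfl fun s _ => ?_
  simp [Pi.single_apply]

theorem measurable_count (t : ℕ) (i : Fin k) :
    Measurable fun ω : ℕ → Fin k => (count ω t i : ℝ) := by
  simp_rw [count_eq_sum]
  exact Finset.measurable_sum _ fun s _ =>
    (measurable_of_countable (Pi.single i 1 : Fin k → ℝ)).comp (measurable_pi_apply s)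

theorem count_mono (ω : ℕ → Fin k) {s t : ℕ} (h : s ≤ t) (i : Fin k) :
    count ω s i ≤ count ω t i :=
  Finset.card_le_card (Finset.filter_subset_filter _ (Finset.range_mono h))

/-- Chebyshev's inequality for the number of times that side `i` shows between two throws. -/
theorem measure_count_sub_le (d : Die k) (s t : ℕ) (i : Fin k) {c : ℝ} (hc : 0 < c) :
    d.throws {ω | c ≤ |(count ω t i : ℝ) - count ω s i - d.prob i * ((t : ℝ) - s)|} ≤
      ENNReal.ofReal (|(t : ℝ) - s| / c ^ 2) := by
  wlog hst : s ≤ t generalizing s t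
  · convert! this t s (le_of_not_ge hst) using 3
    · ext ω
      rw [← abs_neg]
      ring_nf
    · rw [abs_sub_comm]
  let f : Fin k → ℝ := Pi.single i 1
  let X : ℕ → (ℕ → Fin k) → ℝ := fun r ω => f (ω r)
  let Y : (ℕ → Fin k) → ℝ := fun ω => ∑ r ∈ Finset.Ico s t, X r ω
  have hf : ∑ j, d.prob j * f j = d.prob i := by simp [f, Pi.single_apply]
  have hf2 : ∑ j, d.prob j * f j ^ 2 = d.prob i := by simp [f, Pi.single_apply]
  have hX : ∀ r, MemLp (X r) 2 d.throws := d.memLp_throws f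
  have hY : MemLp Y 2 d.throws := memLp_finsetSum _ fun r _ => hX r
  have hmean : ∫ ω, Y ω ∂d.throws = d.prob i * ((t : ℝ) - s) := by
    rw [integral_finsetSum _ fun r _ => (hX r).integrable (by norm_num)]
    simp_rw [X, d.integral_throws, hf]
    rw [Finset.sum_const, Nat.card_Ico, nsmul_eq_mul, Nat.cast_sub hst, mul_comm]
  have hvar : Var[Y; d.throws] ≤ |(t : ℝ) - s| := by
    have h1 : Var[Y; d.throws] = ∑ r ∈ Finset.Ico s t, Var[X r; d.throws] := by
      have := IndepFun.variance_sum (μ := d.throws) (X := X) (s := Finset.Ico s t)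
        (fun r _ => hX r) fun r _ r' _ hrr' => (d.iIndepFun_throws f).indepFun hrr'
      rw [← this]
      congr 1
      ext ω
      simp [Y]
    have h2 : ∀ r, Var[X r; d.throws] ≤ 1 := fun r => by
      have hp1 : d.prob i ≤ 1 := by
        rw [← d.sum_prob]
        exact Finset.single_le_sum (fun j _ => (d.prob_pos j).le) (Finset.mem_univ i)
      rw [d.variance_throws, hf, hf2]
      nlinarith [sq_nonneg (d.prob i)]
    rw [h1]
    refine (Finset.sum_le_sum fun r _ => h2 r).trans ?_
    rw [Finset.sum_const, Nat.card_Ico, nsmul_eq_mul, Nat.cast_sub hst, mul_one]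
    exact le_abs_self _
  have hYeq : ∀ ω, Y ω = (count ω t i : ℝ) - count ω s i := fun ω => by
    rw [count_eq_sum, count_eq_sum, ← Finset.sum_Ico_eq_sub _ hst]
  have := meas_ge_le_variance_div_sq hY hc
  simp_rw [hmean, hYeq] at this
  refine this.trans (ENNReal.ofReal_le_ofReal ?_)
  gcongr

/-! ### The central limit theorem for the counts -/

/-- The normalized deviations of the numbers of times that the sides show in the first `n` throws. -/
noncomputable def countDev (d : Die k) (n : ℕ) (ω : ℕ → Fin k) : Fin k → ℝ :=
  fun i => ((count ω n i : ℝ) - n * d.prob i) / √(n : ℝ)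

/-- The law of the throws, as a probability measure. -/
noncomputable def throwLaw (d : Die k) : ProbabilityMeasure (ℕ → Fin k) :=
  ⟨d.throws, inferInstance⟩

/-- The law of `k` independent standard normal variables, as a probability measure. -/
noncomputable def normalLaw (k : ℕ) : ProbabilityMeasure (Fin k → ℝ) :=
  ⟨normals k, inferInstance⟩

theorem measurable_countDev (d : Die k) (n : ℕ) : Measurable (countDev d n) :=
  measurable_pi_lambda _ fun i => ((measurable_count n i).sub_const _).div_const _

/-- The limit in distribution of the normalized deviations of the counts, as a function of
independent standard normal variables. -/
noncomputable def limitDev (d : Die k) (z : Fin k → ℝ) : Fin k → ℝ :=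
  fun i => d.prob i * ∑ j, √(d.prob j) * z j - √(d.prob i) * z i

theorem continuous_limitDev (d : Die k) : Continuous (limitDev d) := by
  unfold limitDev
  fun_prop

/-- Since `∑ u_i count_i` is the sum of the i.i.d. variables `u (ω s)`, this is the one-dimensional
central limit theorem, read off at frequency `1`. -/
theorem charFun_countDev_tendsto (d : Die k) (u : EuclideanSpace ℝ (Fin k)) :
    Tendsto (fun n => ∫ ω, Complex.exp ((∑ i, u i * countDev d n ω i : ℝ) * Complex.I) ∂d.throws)
      atTop (𝓝 (Complex.exp
        (-(∑ i, d.prob i * u i ^ 2 - (∑ i, d.prob i * u i) ^ 2 : ℝ) / 2))) := by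
  let X : ℕ → (ℕ → Fin k) → ℝ := fun s ω => u (ω s)
  have hv : Var[X 0; d.throws] = ∑ i, d.prob i * u i ^ 2 - (∑ i, d.prob i * u i) ^ 2 :=
    d.variance_throws u 0
  have hclt := tendstoInDistribution_inv_sqrt_mul_sum_sub (X := X) (P := d.throws)
    (P' := gaussianReal 0 Var[X 0; d.throws].toNNReal) (Y := id) ⟨aemeasurable_id, Measure.map_id⟩
    (d.memLp_throws u 0) (d.iIndepFun_throws u) (d.identDistrib_throws u)
  have h1 := ProbabilityMeasure.tendsto_iff_tendsto_charFun.1 hclt.tendsto 1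
  simp only [ProbabilityMeasure.coe_mk, Measure.map_id, charFun_gaussianReal] at h1
  rw [hv] at h1
  convert! h1 using 2 with n
  · rw [charFun_apply_real, integral_map (hclt.forall_aemeasurable n)
      (by fun_prop)]
    congr 1 with ω
    congr 2
    have hsum : ∑ i, u i * countDev d n ω i =
        (√(n : ℝ))⁻¹ * (∑ s ∈ Finset.range n, X s ω - n * ∫ ω, X 0 ω ∂d.throws) := by
      rw [d.integral_throws u 0, ← sum_mul_count, Finset.mul_sum, ← Finset.sum_sub_distrib,
        Finset.mul_sum]
      refine Finset.sum_congr rfl fun i _ => ?_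
      rw [countDev]
      ring
    rw [hsum]
    simp
  · rw [Real.coe_toNNReal _ (hv ▸ variance_nonneg _ _)]
    congr 1
    push_cast
    ring

/-- `limitDev` is linear in `z`, and its covariance is that of one throw, `diag(p) - p pᵀ`. -/
theorem charFun_limitDev (d : Die k) (u : EuclideanSpace ℝ (Fin k)) :
    ∫ z, Complex.exp ((∑ i, u i * limitDev d z i : ℝ) * Complex.I) ∂normals k =
      Complex.exp (-(∑ i, d.prob i * u i ^ 2 - (∑ i, d.prob i * u i) ^ 2 : ℝ) / 2) := by
  let c : Fin k → ℝ := fun i => √(d.prob i) * (∑ j, d.prob j * u j - u i)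
  have hsum : ∀ z, ∑ i, u i * limitDev d z i = ∑ i, z i * c i := fun z => by
    simp only [limitDev, mul_sub, Finset.sum_sub_distrib, c]
    congr 1
    · simp_rw [← mul_assoc]
      rw [← Finset.sum_mul, Finset.mul_sum]
      refine Finset.sum_congr rfl fun i _ => ?_
      rw [Finset.sum_congr rfl fun j _ => mul_comm (u j) (d.prob j)]
      ring
    · exact Finset.sum_congr rfl fun i _ => by ring
  have hc : ∑ i, c i ^ 2 = ∑ i, d.prob i * u i ^ 2 - (∑ i, d.prob i * u i) ^ 2 := by
    set m := ∑ i, d.prob i * u i with hm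
    have : ∀ i, c i ^ 2 = m ^ 2 * d.prob i - 2 * m * (d.prob i * u i) + d.prob i * u i ^ 2 :=
      fun i => by
        simp only [c, mul_pow, Real.sq_sqrt (d.prob_pos i).le]
        ring
    simp_rw [this, Finset.sum_add_distrib, Finset.sum_sub_distrib, ← Finset.mul_sum, ← hm,
      d.sum_prob]
    ring
  have h := charFun_pi (E := fun _ : Fin k => ℝ) (μ := fun _ : Fin k => gaussianReal 0 1)
    (WithLp.toLp 2 c)
  rw [charFun_apply, integral_map (by fun_prop) (by fun_prop)] at h
  simp only [charFun_gaussianReal, PiLp.inner_apply] at h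
  rw [← Complex.exp_sum] at h
  rw [← hc]
  convert! h using 1
  · simp_rw [hsum, normals]
    congr 1 with z
    congr 3
    refine Finset.sum_congr rfl fun i _ => ?_
    simp [mul_comm]
  · congr 1
    push_cast
    rw [← Finset.sum_neg_distrib, Finset.sum_div]
    refine Finset.sum_congr rfl fun i _ => ?_
    simp [neg_div]

/-- The central limit theorem for the counts. -/
theorem tendsto_map_countDev (d : Die k) :
    Tendsto (fun n => (throwLaw d).map (measurable_countDev d n).aemeasurable) atTop
      (𝓝 ((normalLaw k).map (continuous_limitDev d).measurable.aemeasurable)) := by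
  -- Characteristic functions use the inner product of the Euclidean space; the convergence is
  -- carried back along the continuous identity map.
  let e : (Fin k → ℝ) → EuclideanSpace ℝ (Fin k) := WithLp.toLp 2
  have he : Continuous e := by fun_prop
  have h : Tendsto (fun n => (throwLaw d).map
        (he.measurable.comp (measurable_countDev d n)).aemeasurable) atTop
      (𝓝 ((normalLaw k).map (he.measurable.comp (continuous_limitDev d).measurable).aemeasurable)) := by
    refine ProbabilityMeasure.tendsto_of_tendsto_charFun fun u => ?_
    convert! charFun_countDev_tendsto d u using 2 with n
    · rw [charFun_apply, ProbabilityMeasure.toMeasure_map, integral_map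
        (he.measurable.comp (measurable_countDev d n)).aemeasurable (by fun_prop)]
      congr 1 with ω
    · rw [← charFun_limitDev, charFun_apply, ProbabilityMeasure.toMeasure_map, integral_map
        (he.measurable.comp (continuous_limitDev d).measurable).aemeasurable (by fun_prop)]
      congr 1 with z
  let g : EuclideanSpace ℝ (Fin k) → Fin k → ℝ := WithLp.ofLp
  have hg : Continuous g := by fun_prop
  have h' := ProbabilityMeasure.tendsto_map_of_tendsto_of_continuous _ _ h hg
  convert! h' using 2 with n
  · refine Subtype.ext ?_
    simp only [ProbabilityMeasure.val_eq_to_measure, ProbabilityMeasure.toMeasure_map]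
    rw [Measure.map_map hg.measurable (he.measurable.comp (measurable_countDev d n))]
    rfl
  · refine Subtype.ext ?_
    simp only [ProbabilityMeasure.val_eq_to_measure, ProbabilityMeasure.toMeasure_map]
    rw [Measure.map_map hg.measurable (he.measurable.comp (continuous_limitDev d).measurable)]
    rfl

/-! ### The game with many tokens -/

/-- Counts increase with time, so being cleared persists, and a strict win is witnessed at a single
time. This also covers the value `⊤`. -/
theorem tokenTime_lt_iff (η ξ : Fin k → ℕ) (ω : ℕ → Fin k) :
    tokenTime η ω < tokenTime ξ ω ↔
      ∃ t : ℕ, (∀ i, η i ≤ count ω t i) ∧ ∃ i, count ω t i < ξ i := by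
  constructor
  · intro h
    obtain ⟨-, ⟨t, ht, rfl⟩, hlt⟩ := sInf_lt_iff.1 h
    refine ⟨t, ht, ?_⟩
    by_contra! hξ
    exact absurd hlt (not_lt.2 (sInf_le ⟨t, hξ, rfl⟩))
  · rintro ⟨t, ht, i, hi⟩
    refine lt_of_le_of_lt (sInf_le ⟨t, ht, rfl⟩) ?_
    have h : ((t + 1 : ℕ) : ℕ∞) ≤ tokenTime ξ ω := by
      refine le_sInf ?_
      rintro - ⟨s, hs, rfl⟩
      have hts : t + 1 ≤ s := by
        by_contra! hst
        have := count_mono ω (Nat.lt_succ_iff.1 hst) i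
        have := hs i
        omega
      exact Nat.cast_le.2 hts
    exact lt_of_lt_of_le (Nat.cast_lt.2 (Nat.lt_succ_self t)) h

theorem measurableSet_tokenTime_lt {X : Type*} [MeasurableSpace X] {f g : X → Fin k → ℕ}
    {h : X → ℕ → Fin k} (hf : Measurable f) (hg : Measurable g) (hh : Measurable h) :
    MeasurableSet {q | tokenTime (f q) (h q) < tokenTime (g q) (h q)} := by
  have hc : ∀ t i, Measurable fun q => count (h q) t i := fun t i => by
    have : Measurable fun ω : ℕ → Fin k => count ω t i := by
      have h := Nat.measurable_floor.comp (measurable_count t i)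
      simpa [Function.comp_def] using h
    exact this.comp hh
  have hf' : ∀ i, Measurable fun q => f q i := fun i => (measurable_pi_apply i).comp hf
  have hg' : ∀ i, Measurable fun q => g q i := fun i => (measurable_pi_apply i).comp hg
  have hset : {q | tokenTime (f q) (h q) < tokenTime (g q) (h q)} =
      ⋃ t : ℕ, (⋂ i, {q | f q i ≤ count (h q) t i}) ∩ ⋃ i, {q | count (h q) t i < g q i} := by
    ext q
    simp [tokenTime_lt_iff]
  rw [hset]
  refine MeasurableSet.iUnion fun t => MeasurableSet.inter ?_ ?_
  · exact MeasurableSet.iInter fun i => measurableSet_le (hf' i) (hc t i)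
  · exact MeasurableSet.iUnion fun i => measurableSet_lt (hc t i) (hg' i)

theorem tokenPayoff_le (d : Die k) (ξ η : Fin k → ℕ) :
    tokenPayoff d ξ η ≤ 1 / 2 - d.throws.real {ω | tokenTime η ω < tokenTime ξ ω} := by
  have h1 : d.throws.real {ω | tokenTime ξ ω < tokenTime η ω} ≤
      d.throws.real {ω | tokenTime η ω < tokenTime ξ ω}ᶜ := by
    refine measureReal_mono fun ω hω => ?_
    simpa using le_of_lt hω
  rw [probReal_compl_eq_one_sub
    (measurableSet_tokenTime_lt (f := fun _ => η) (g := fun _ => ξ) (h := fun ω => ω)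
      measurable_const measurable_const measurable_id)] at h1
  rw [tokenPayoff]
  linarith

theorem tokenMixedPayoff_le (d : Die k) {n : ℕ} (a : TokenStrategy k n) (η : Allocation k n) :
    tokenMixedPayoff d a η ≤ 1 / 2 - ((a : Measure (Allocation k n)).prod d.throws).real
      {q | tokenTime η.1 q.2 < tokenTime q.1.1 q.2} := by
  have hW : MeasurableSet {q : Allocation k n × (ℕ → Fin k) |
      tokenTime η.1 q.2 < tokenTime q.1.1 q.2} :=
    measurableSet_tokenTime_lt measurable_const (by fun_prop) measurable_snd
  have hm := measurable_measure_prodMk_left (ν := d.throws) hW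
  have hi : Integrable (fun ξ : Allocation k n =>
      d.throws.real {ω | tokenTime η.1 ω < tokenTime ξ.1 ω}) (a : Measure (Allocation k n)) := by
    refine .of_bound hm.ennreal_toReal.aestronglyMeasurable 1 (ae_of_all _ fun x => ?_)
    rw [Real.norm_of_nonneg measureReal_nonneg]
    exact measureReal_le_one
  have hp : Integrable (fun ξ : Allocation k n => tokenPayoff d ξ.1 η.1)
      (a : Measure (Allocation k n)) := by
    refine .of_bound (measurable_of_countable _).aestronglyMeasurable 1 (ae_of_all _ fun ξ => ?_)
    have h1 : d.throws.real {ω | tokenTime ξ.1 ω < tokenTime η.1 ω} ≤ 1 := measureReal_le_one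
    have h2 : d.throws.real {ω | tokenTime η.1 ω < tokenTime ξ.1 ω} ≤ 1 := measureReal_le_one
    have h3 : 0 ≤ d.throws.real {ω | tokenTime ξ.1 ω < tokenTime η.1 ω} := measureReal_nonneg
    have h4 : 0 ≤ d.throws.real {ω | tokenTime η.1 ω < tokenTime ξ.1 ω} := measureReal_nonneg
    rw [tokenPayoff, Real.norm_eq_abs, abs_le]
    constructor <;> linarith
  have h := integral_mono hp ((integrable_const (1 / 2)).sub hi) fun ξ => tokenPayoff_le d ξ.1 η.1
  refine h.trans_eq ?_
  refine (integral_sub (integrable_const _) hi).trans ?_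
  rw [measureReal_def, Measure.prod_apply hW,
    ← integral_toReal hm.aemeasurable (ae_of_all _ fun x => measure_lt_top _ _)]
  simp only [integral_const, probReal_univ, one_smul]
  rfl

theorem sum_rescale (d : Die k) (n : ℕ) (ξ : Allocation k n) : ∑ i, rescale d n ξ i = 0 := by
  have h : ∑ i, (ξ.1 i : ℝ) = n := by exact_mod_cast ξ.2
  simp only [rescale]
  rw [← Finset.sum_div, Finset.sum_sub_distrib, h, ← Finset.mul_sum, d.sum_prob, mul_one, sub_self,
    zero_div]

/-- A vector of nonnegative reals with sum `n` can be rounded to an allocation of `n` tokens. -/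
theorem exists_allocation_near [Nonempty (Fin k)] {n : ℕ} {r : Fin k → ℝ} (hr : ∀ i, 0 ≤ r i)
    (hsum : ∑ i, r i = n) : ∃ ξ : Allocation k n, ∀ i, |(ξ.1 i : ℝ) - r i| ≤ k := by
  classical
  let i₀ : Fin k := Classical.arbitrary _
  have hk : (1 : ℝ) ≤ k := by exact_mod_cast Fin.pos_iff_nonempty.2 ‹_›
  let s : ℕ := ∑ i ∈ Finset.univ.erase i₀, ⌊r i⌋₊
  have hs : (s : ℝ) ≤ n - r i₀ ∧ n - r i₀ - s ≤ k := by
    have h1 := Finset.add_sum_erase Finset.univ r (Finset.mem_univ i₀)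
    have h2 : (s : ℝ) ≤ ∑ i ∈ Finset.univ.erase i₀, r i := by
      push_cast [s]
      exact Finset.sum_le_sum fun i _ => Nat.floor_le (hr i)
    have h3 : ∑ i ∈ Finset.univ.erase i₀, r i - s ≤ k := by
      push_cast [s]
      rw [← Finset.sum_sub_distrib]
      refine (Finset.sum_le_sum (g := fun _ => (1 : ℝ)) fun i _ => ?_).trans ?_
      · linarith [Nat.lt_floor_add_one (r i)]
      · rw [Finset.sum_const, Finset.card_erase_of_mem (Finset.mem_univ _), Finset.card_univ,
          Fintype.card_fin, nsmul_eq_mul, mul_one]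
        exact_mod_cast Nat.sub_le k 1
    constructor <;> linarith
  have hsn : s ≤ n := by
    have : (s : ℝ) ≤ n := by linarith [hs.1, hr i₀]
    exact_mod_cast this
  -- All bins but `i₀` are rounded down, and `i₀` receives what is left.
  refine ⟨⟨fun i => if i = i₀ then n - s else ⌊r i⌋₊, ?_⟩, fun i => ?_⟩
  · rw [← Finset.add_sum_erase _ _ (Finset.mem_univ i₀), if_pos rfl]
    have : ∑ i ∈ Finset.univ.erase i₀, (if i = i₀ then n - s else ⌊r i⌋₊) = s :=
      Finset.sum_congr rfl fun i hi => if_neg (Finset.ne_of_mem_erase hi)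
    omega
  · by_cases hi : i = i₀
    · subst hi
      simp only [if_true]
      rw [Nat.cast_sub hsn, abs_le]
      constructor <;> linarith
    · simp only [hi, if_false]
      have h1 := Nat.floor_le (hr i)
      have h2 := Nat.lt_floor_add_one (r i)
      rw [abs_le]
      constructor <;> linarith

theorem tendsto_sqrt_natCast : Tendsto (fun n : ℕ => √(n : ℝ)) atTop atTop :=
  Real.tendsto_sqrt_atTop.comp tendsto_natCast_atTop_atTop

theorem exists_tendsto_rescale (d : Die k) {y : Fin k → ℝ} (hy : ∑ i, y i = 0) :
    ∃ η : ∀ n, Allocation k n, Tendsto (fun n => rescale d n (η n)) atTop (𝓝 y) := by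
  have := d.nonempty
  -- The target `n p + √n y` may have negative entries for small `n`; any allocation serves there.
  -- Otherwise the rounding error is at most `k`, which is negligible against `√n`.
  have hex : ∀ n : ℕ, ∃ ξ : Allocation k n, (∀ i, 0 ≤ n * d.prob i + √(n : ℝ) * y i) →
      ∀ i, |(ξ.1 i : ℝ) - (n * d.prob i + √(n : ℝ) * y i)| ≤ k := by
    intro n
    by_cases h : ∀ i, 0 ≤ n * d.prob i + √(n : ℝ) * y i
    · obtain ⟨ξ, hξ⟩ := exists_allocation_near (n := n) h (by
        rw [Finset.sum_add_distrib, ← Finset.mul_sum, ← Finset.mul_sum, hy, d.sum_prob]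
        simp)
      exact ⟨ξ, fun _ => hξ⟩
    · exact ⟨⟨Pi.single (Classical.arbitrary _) n, by simp⟩, fun h' => absurd h' h⟩
  choose η hη using hex
  refine ⟨η, tendsto_pi_nhds.2 fun i => ?_⟩
  have hev : ∀ᶠ n : ℕ in atTop, ∀ i, 0 ≤ n * d.prob i + √(n : ℝ) * y i := by
    refine eventually_all.2 fun i => ?_
    filter_upwards [tendsto_sqrt_natCast.eventually_ge_atTop (-y i / d.prob i)] with n hn
    rw [div_le_iff₀ (d.prob_pos i)] at hn
    have h1 : (n : ℝ) = √(n : ℝ) * √(n : ℝ) := (Real.mul_self_sqrt (Nat.cast_nonneg n)).symm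
    have h2 : 0 ≤ √(n : ℝ) := Real.sqrt_nonneg _
    rw [h1, Real.sqrt_mul_self h2, mul_assoc, ← mul_add]
    exact mul_nonneg h2 (by linarith)
  rw [tendsto_iff_norm_sub_tendsto_zero]
  refine squeeze_zero' (g := fun n : ℕ => (k : ℝ) / √(n : ℝ))
    (Eventually.of_forall fun n => norm_nonneg _) ?_
    (tendsto_const_nhds.div_atTop tendsto_sqrt_natCast)
  filter_upwards [hev, eventually_gt_atTop 0] with n hn hn0
  have hs : 0 < √(n : ℝ) := Real.sqrt_pos.2 (by exact_mod_cast hn0)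
  have : rescale d n (η n) i - y i =
      (((η n).1 i : ℝ) - (n * d.prob i + √(n : ℝ) * y i)) / √(n : ℝ) := by
    rw [rescale]
    field_simp
    ring
  rw [this, norm_div, Real.norm_of_nonneg hs.le, Real.norm_eq_abs]
  gcongr
  exact hη n hn i

/-! ### Comparison of the players at finitely many times near `n` -/

/-- The numbers of throws `t` that are compared: about `c √n` more than `n`. -/
noncomputable def throwIndex (n : ℕ) (c : ℝ) : ℕ := ⌊(n : ℝ) + c * √(n : ℝ)⌋₊

/-- Only eventually, since the natural floor of a negative number is `0`. -/
theorem eventually_abs_throwIndex (c : ℝ) :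
    ∀ᶠ n : ℕ in atTop, |(throwIndex n c : ℝ) - n - c * √(n : ℝ)| ≤ 1 := by
  filter_upwards [tendsto_sqrt_natCast.eventually_ge_atTop (-c)] with n hn
  have h1 : (n : ℝ) = √(n : ℝ) * √(n : ℝ) := (Real.mul_self_sqrt (Nat.cast_nonneg n)).symm
  have h0 : 0 ≤ (n : ℝ) + c * √(n : ℝ) := by
    nlinarith [Real.sqrt_nonneg (n : ℝ)]
  have h2 := Nat.floor_le h0
  have h3 := Nat.lt_floor_add_one ((n : ℝ) + c * √(n : ℝ))
  rw [throwIndex, abs_le]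
  constructor <;> linarith

/-- Between `n` and about `n + c √n` throws, the counts deviate from their means by `o(√n)`. -/
theorem tendsto_measure_count_sub (d : Die k) (c : ℝ) (i : Fin k) {ε : ℝ} (hε : 0 < ε) :
    Tendsto (fun n : ℕ => d.throws {ω | ε * √(n : ℝ) ≤
      |(count ω (throwIndex n c) i : ℝ) - count ω n i - d.prob i * ((throwIndex n c : ℝ) - n)|})
      atTop (𝓝 0) := by
  have hlim : Tendsto (fun n : ℕ => ENNReal.ofReal
      ((|c| / ε ^ 2) / √(n : ℝ) + (1 / ε ^ 2) / (n : ℝ))) atTop (𝓝 0) := by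
    rw [← ENNReal.ofReal_zero, ← add_zero (0 : ℝ)]
    exact ENNReal.tendsto_ofReal ((tendsto_const_nhds.div_atTop tendsto_sqrt_natCast).add
      (tendsto_const_nhds.div_atTop tendsto_natCast_atTop_atTop))
  refine tendsto_of_tendsto_of_tendsto_of_le_of_le' tendsto_const_nhds hlim
    (Eventually.of_forall fun n => zero_le) ?_
  filter_upwards [eventually_abs_throwIndex c, eventually_gt_atTop 0] with n hn hn0
  have hs : 0 < √(n : ℝ) := Real.sqrt_pos.2 (by exact_mod_cast hn0)
  have hsq : √(n : ℝ) ^ 2 = n := Real.sq_sqrt (Nat.cast_nonneg n)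
  refine (measure_count_sub_le d n (throwIndex n c) i (mul_pos hε hs)).trans
    (ENNReal.ofReal_le_ofReal ?_)
  have h1 : |(throwIndex n c : ℝ) - n| ≤ |c| * √(n : ℝ) + 1 := by
    calc |(throwIndex n c : ℝ) - n|
        = |((throwIndex n c : ℝ) - n - c * √(n : ℝ)) + c * √(n : ℝ)| := by ring_nf
      _ ≤ |(throwIndex n c : ℝ) - n - c * √(n : ℝ)| + |c * √(n : ℝ)| := abs_add_le _ _
      _ ≤ |c| * √(n : ℝ) + 1 := by
        rw [abs_mul, abs_of_pos hs]
        linarith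
  have h2 : |c| / ε ^ 2 / √(n : ℝ) + 1 / ε ^ 2 / (n : ℝ) =
      (|c| * √(n : ℝ) + 1) / (ε * √(n : ℝ)) ^ 2 := by
    rw [mul_pow, div_add_div _ _ hs.ne' (by positivity), div_eq_div_iff (by positivity)
      (by positivity), ← hsq, Real.sqrt_sq hs.le]
    field_simp
  rw [h2]
  gcongr

/-- The deviations of an allocation and of the counts for which, by a margin, the allocation `y`
is cleared before the other one at one of finitely many times. -/
def earlySet (d : Die k) (y : Fin k → ℝ) (c : ℕ → ℝ) (m : ℕ) :
    Set ((Fin k → ℝ) × (Fin k → ℝ)) :=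
  {q | ∃ j ∈ Finset.range (m + 1), (∀ i, y i + 1 / ((m : ℝ) + 1) < q.2 i + d.prob i * c j) ∧
    ∃ i, q.2 i + d.prob i * c j + 1 / ((m : ℝ) + 1) < q.1 i}

/-- Openness allows the portmanteau bound for the joint law of the allocation and the counts. -/
theorem isOpen_earlySet (d : Die k) (y : Fin k → ℝ) (c : ℕ → ℝ) (m : ℕ) :
    IsOpen (earlySet d y c m) := by
  have : earlySet d y c m = ⋃ j ∈ Finset.range (m + 1),
      (⋂ i, {q | y i + 1 / ((m : ℝ) + 1) < q.2 i + d.prob i * c j}) ∩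
        ⋃ i, {q | q.2 i + d.prob i * c j + 1 / ((m : ℝ) + 1) < q.1 i} := by
    ext q
    simp only [earlySet, Set.mem_iUnion, Set.mem_inter_iff, Set.mem_iInter, Set.mem_ofPred_eq,
      exists_prop]
  rw [this]
  refine isOpen_biUnion fun j _ => (isOpen_iInter_of_finite fun i => ?_).inter
    (isOpen_iUnion fun i => ?_)
  · exact isOpen_lt (by fun_prop) (by fun_prop)
  · exact isOpen_lt (by fun_prop) (by fun_prop)

theorem monotone_earlySet (d : Die k) (y : Fin k → ℝ) (c : ℕ → ℝ) :
    Monotone (earlySet d y c) := by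
  rintro m m' hm q ⟨j, hj, h1, i, h2⟩
  have hle : 1 / ((m' : ℝ) + 1) ≤ 1 / ((m : ℝ) + 1) := by gcongr
  refine ⟨j, Finset.range_mono (by omega) hj, fun l => ?_, i, ?_⟩
  · linarith [h1 l]
  · linarith

/-- At time parameter `c j` the deviation in bin `i` is `p_i (s + c j - z_i / √p_i)`. So any `c j`
strictly between the two clearance times, both shifted by `s`, shows `y` cleared and `x` not. -/
theorem mem_iUnion_earlySet (d : Die k) {x y z : Fin k → ℝ} {c : ℕ → ℝ} (hc : DenseRange c)
    (h : contTime d y z < contTime d x z) : (x, limitDev d z) ∈ ⋃ m, earlySet d y c m := by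
  set s : ℝ := ∑ j, √(d.prob j) * z j with hs
  obtain ⟨j, hj1, hj2⟩ := hc.exists_mem_open isOpen_Ioo
    (Set.nonempty_Ioo.2 (show contTime d y z - s < contTime d x z - s by linarith))
  have hdev : ∀ i, limitDev d z i + d.prob i * c j =
      d.prob i * (s + c j - z i / √(d.prob i)) := fun i => by
    have h1 := (d.sqrt_prob_pos i).ne'
    have h2 : d.prob i / √(d.prob i) = √(d.prob i) := Real.div_sqrt
    rw [limitDev, ← hs]
    linear_combination z i * h2
  have hlt : ∀ i, y i < limitDev d z i + d.prob i * c j := fun i => by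
    have h1 := (contTime_lt_iff d).1 (show contTime d y z < s + c j by linarith) i
    have h2 : y i / d.prob i < s + c j - z i / √(d.prob i) := by linarith
    rw [div_lt_iff₀ (d.prob_pos i)] at h2
    rw [hdev]
    linarith
  obtain ⟨i, hi⟩ : ∃ i, limitDev d z i + d.prob i * c j < x i := by
    obtain ⟨i, hi⟩ := (lt_contTime_iff d).1 (show s + c j < contTime d x z by linarith)
    refine ⟨i, ?_⟩
    have h2 : s + c j - z i / √(d.prob i) < x i / d.prob i := by linarith
    rw [lt_div_iff₀ (d.prob_pos i)] at h2
    rw [hdev]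
    linarith
  have hev1 : ∀ᶠ m : ℕ in atTop, ∀ l, 1 / ((m : ℝ) + 1) <
      limitDev d z l + d.prob l * c j - y l :=
    eventually_all.2 fun l =>
      tendsto_one_div_add_atTop_nhds_zero_nat.eventually_lt_const (sub_pos.2 (hlt l))
  have hev2 : ∀ᶠ m : ℕ in atTop, 1 / ((m : ℝ) + 1) <
      x i - (limitDev d z i + d.prob i * c j) :=
    tendsto_one_div_add_atTop_nhds_zero_nat.eventually_lt_const (sub_pos.2 hi)
  obtain ⟨m, h1, h2, hm⟩ := (hev1.and (hev2.and (eventually_ge_atTop j))).exists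
  refine Set.mem_iUnion.2 ⟨m, j, Finset.mem_range.2 (by omega), fun l => ?_, i, ?_⟩
  · have := h1 l
    dsimp only
    linarith
  · dsimp only
    linarith

/-- If the deviations are in the early set, and the counts do not deviate much after `n` throws,
then `η` beats `ξ`. -/
theorem tokenTime_lt_of_mem_earlySet (d : Die k) {y : Fin k → ℝ} {c : ℕ → ℝ} {m n : ℕ}
    (hn0 : 0 < n) (hn : 4 * ((m : ℝ) + 1) ≤ √(n : ℝ)) {η ξ : Allocation k n}
    (hη : ∀ i, rescale d n η i ≤ y i + 1 / ((m : ℝ) + 1) / 4)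
    (hidx : ∀ j ∈ Finset.range (m + 1), |(throwIndex n (c j) : ℝ) - n - c j * √(n : ℝ)| ≤ 1)
    {ω : ℕ → Fin k} (hω : (rescale d n ξ, countDev d n ω) ∈ earlySet d y c m)
    (hdev : ∀ j ∈ Finset.range (m + 1), ∀ i,
      |(count ω (throwIndex n (c j)) i : ℝ) - count ω n i -
        d.prob i * ((throwIndex n (c j) : ℝ) - n)| < 1 / ((m : ℝ) + 1) / 2 * √(n : ℝ)) :
    tokenTime η.1 ω < tokenTime ξ.1 ω := by
  obtain ⟨j, hj, h1, i₀, h2⟩ := hω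
  dsimp only at h1 h2
  set δ : ℝ := 1 / ((m : ℝ) + 1) with hδ
  have hs : 0 < √(n : ℝ) := Real.sqrt_pos.2 (by exact_mod_cast hn0)
  -- The margin `δ √n` pays for three errors: `δ / 4` for approximating `y` by `η`, `δ / 4` for the
  -- floor in `throwIndex`, and `δ / 2` for the fluctuation of the counts after `n` throws.
  have hδs : 1 ≤ δ / 4 * √(n : ℝ) := by
    rw [hδ, div_div, div_mul_eq_mul_div, one_mul, le_div_iff₀ (by positivity)]
    linarith
  have hres : ∀ (ζ : Allocation k n) i,
      (ζ.1 i : ℝ) = n * d.prob i + √(n : ℝ) * rescale d n ζ i := fun ζ i => by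
    rw [rescale]
    field_simp
    ring
  have hcnt : ∀ i, (count ω n i : ℝ) = n * d.prob i + √(n : ℝ) * countDev d n ω i := fun i => by
    rw [countDev]
    field_simp
    ring
  have hpt : ∀ i, |d.prob i * ((throwIndex n (c j) : ℝ) - n - c j * √(n : ℝ))| ≤
      δ / 4 * √(n : ℝ) := fun i => by
    have hp1 : d.prob i ≤ 1 := by
      rw [← d.sum_prob]
      exact Finset.single_le_sum (fun j _ => (d.prob_pos j).le) (Finset.mem_univ i)
    rw [abs_mul, abs_of_pos (d.prob_pos i)]
    exact (mul_le_one₀ hp1 (abs_nonneg _) (hidx j hj)).trans hδs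
  refine (tokenTime_lt_iff _ _ _).2 ⟨throwIndex n (c j), fun i => ?_, i₀, ?_⟩
  · have hd := (abs_lt.1 (hdev j hj i)).1
    have hp := (abs_le.1 (hpt i)).1
    have h3 := mul_le_mul_of_nonneg_left (hη i) hs.le
    have h4 := mul_lt_mul_of_pos_left (h1 i) hs
    have : (η.1 i : ℝ) ≤ count ω (throwIndex n (c j)) i := by
      rw [hres]
      have := hcnt i
      linarith
    exact_mod_cast this
  · have hd := (abs_lt.1 (hdev j hj i₀)).2
    have hp := (abs_le.1 (hpt i₀)).2
    have h4 := mul_lt_mul_of_pos_left h2 hs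
    have : (count ω (throwIndex n (c j)) i₀ : ℝ) < ξ.1 i₀ := by
      rw [hres]
      have := hcnt i₀
      have : 0 < δ * √(n : ℝ) := by positivity
      linarith
    exact_mod_cast this

theorem tendsto_measure_exists_count_sub (d : Die k) (c : ℕ → ℝ) (m : ℕ) {ε : ℝ} (hε : 0 < ε) :
    Tendsto (fun n : ℕ => d.throws {ω | ∃ j ∈ Finset.range (m + 1), ∃ i, ε * √(n : ℝ) ≤
      |(count ω (throwIndex n (c j)) i : ℝ) - count ω n i -
        d.prob i * ((throwIndex n (c j) : ℝ) - n)|}) atTop (𝓝 0) := by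
  have hlim : Tendsto (fun n : ℕ => ∑ j ∈ Finset.range (m + 1), ∑ i, d.throws {ω | ε * √(n : ℝ) ≤
      |(count ω (throwIndex n (c j)) i : ℝ) - count ω n i -
        d.prob i * ((throwIndex n (c j) : ℝ) - n)|}) atTop (𝓝 0) := by
    have := tendsto_finsetSum (Finset.range (m + 1)) fun j _ =>
      tendsto_finsetSum (Finset.univ : Finset (Fin k)) fun i _ =>
        tendsto_measure_count_sub d (c j) i hε
    simpa using this
  refine tendsto_of_tendsto_of_tendsto_of_le_of_le tendsto_const_nhds hlim
    (fun n => zero_le) fun n => ?_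
  have hset : {ω : ℕ → Fin k | ∃ j ∈ Finset.range (m + 1), ∃ i, ε * √(n : ℝ) ≤
      |(count ω (throwIndex n (c j)) i : ℝ) - count ω n i -
        d.prob i * ((throwIndex n (c j) : ℝ) - n)|} =
      ⋃ j ∈ Finset.range (m + 1), ⋃ i, {ω | ε * √(n : ℝ) ≤
        |(count ω (throwIndex n (c j)) i : ℝ) - count ω n i -
          d.prob i * ((throwIndex n (c j) : ℝ) - n)|} := by
    ext ω
    simp
  rw [hset]
  exact (measure_biUnion_finset_le _ _).trans
    (Finset.sum_le_sum fun j _ => measure_iUnion_fintype_le _ _)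

/-- For many tokens, the mass of the early set bounds the probability that `η` beats the mixed
strategy from below, and hence the payoff from above. -/
theorem eventually_measure_earlySet_le (d : Die k) {y : Fin k → ℝ} (c : ℕ → ℝ) (m : ℕ)
    {η : ∀ n, Allocation k n} (hη : Tendsto (fun n => rescale d n (η n)) atTop (𝓝 y)) :
    ∀ᶠ n : ℕ in atTop, ∀ a : TokenStrategy k n,
      (((rescaledLaw d a).prod ((throwLaw d).map (measurable_countDev d n).aemeasurable) :
        ProbabilityMeasure _) : Measure ((Fin k → ℝ) × (Fin k → ℝ))) (earlySet d y c m) ≤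
      ENNReal.ofReal (1 / 2 - tokenMixedPayoff d a (η n)) +
        d.throws {ω | ∃ j ∈ Finset.range (m + 1), ∃ i, 1 / ((m : ℝ) + 1) / 2 * √(n : ℝ) ≤
          |(count ω (throwIndex n (c j)) i : ℝ) - count ω n i -
            d.prob i * ((throwIndex n (c j) : ℝ) - n)|} := by
  have hη' : ∀ᶠ n : ℕ in atTop, ∀ i, rescale d n (η n) i < y i + 1 / ((m : ℝ) + 1) / 4 :=
    eventually_all.2 fun i => (tendsto_pi_nhds.1 hη i).eventually_lt_const (by
      have : 0 < 1 / ((m : ℝ) + 1) / 4 := by positivity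
      linarith)
  have hidx : ∀ᶠ n : ℕ in atTop, ∀ j ∈ Finset.range (m + 1),
      |(throwIndex n (c j) : ℝ) - n - c j * √(n : ℝ)| ≤ 1 :=
    (Finset.eventually_all _).2 fun j _ => eventually_abs_throwIndex (c j)
  filter_upwards [hη', hidx, eventually_gt_atTop 0,
    tendsto_sqrt_natCast.eventually_ge_atTop (4 * ((m : ℝ) + 1))] with n h1 h2 h3 h4 a
  set Bad : Set (ℕ → Fin k) := {ω | ∃ j ∈ Finset.range (m + 1), ∃ i,
    1 / ((m : ℝ) + 1) / 2 * √(n : ℝ) ≤ |(count ω (throwIndex n (c j)) i : ℝ) - count ω n i -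
      d.prob i * ((throwIndex n (c j) : ℝ) - n)|} with hBad
  set W : Set (Allocation k n × (ℕ → Fin k)) :=
    {q | tokenTime (η n).1 q.2 < tokenTime q.1.1 q.2} with hW
  have hmap : (((rescaledLaw d a).prod ((throwLaw d).map (measurable_countDev d n).aemeasurable) :
      ProbabilityMeasure _) : Measure ((Fin k → ℝ) × (Fin k → ℝ))) =
      ((a : Measure (Allocation k n)).prod d.throws).map
        (Prod.map (rescale d n) (countDev d n)) := by
    rw [← Measure.map_prod_map _ _ (measurable_of_countable _) (measurable_countDev d n)]
    rfl
  rw [hmap, Measure.map_apply ((measurable_of_countable _).prodMap (measurable_countDev d n))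
    (isOpen_earlySet d y c m).measurableSet]
  have hsub : Prod.map (rescale d n) (countDev d n) ⁻¹' earlySet d y c m ⊆
      W ∪ Set.univ ×ˢ Bad := by
    rintro ⟨ξ, ω⟩ hq
    by_cases hω : ω ∈ Bad
    · exact Or.inr ⟨Set.mem_univ _, hω⟩
    · refine Or.inl (tokenTime_lt_of_mem_earlySet d h3 h4 (fun i => (h1 i).le) h2 hq
        fun j hj i => ?_)
      by_contra! hle
      exact hω ⟨j, hj, i, hle⟩
  refine (measure_mono hsub).trans ((measure_union_le _ _).trans (add_le_add ?_ ?_))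
  · have := tokenMixedPayoff_le d a (η n)
    rw [← ofReal_measureReal (measure_ne_top _ _)]
    exact ENNReal.ofReal_le_ofReal (by linarith)
  · rw [Measure.prod_prod, measure_univ, one_mul]

/-! ### Weak limits of asymptotically optimal strategies -/

theorem isContStrategy_of_tendsto (d : Die k) {n : ℕ → ℕ} {a : ∀ j, TokenStrategy k (n j)}
    {α : ProbabilityMeasure (Fin k → ℝ)}
    (h : Tendsto (fun j => rescaledLaw d (a j)) atTop (𝓝 α)) : IsContStrategy α := by
  -- The rescaled laws live on this closed hyperplane, and by the portmanteau theorem so does the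
  -- limit.
  have hH : IsClosed {x : Fin k → ℝ | ∑ i, x i = 0} := isClosed_eq (by fun_prop) continuous_const
  have hle := ProbabilityMeasure.limsup_measure_closed_le_of_tendsto h hH
  have h1 : ∀ j, (rescaledLaw d (a j) : Measure (Fin k → ℝ)) {x | ∑ i, x i = 0} = 1 := fun j => by
    rw [rescaledLaw, ProbabilityMeasure.toMeasure_map,
      Measure.map_apply (measurable_of_countable _) hH.measurableSet]
    convert! measure_univ (μ := (a j : Measure (Allocation k (n j))))
    ext ξ
    simp [sum_rescale]
  simp only [h1, limsup_const] at hle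
  exact (prob_compl_eq_zero_iff hH.measurableSet).2 (le_antisymm prob_le_one hle)

/-- Weak limits of rescaled asymptotically optimal strategies do not lose against any allocation of
the continuous game. -/
theorem lossProb_le_of_tendsto (d : Die k) {a : ∀ n, TokenStrategy k n}
    (ha : AsymptoticallyOptimal d a) {φ : ℕ → ℕ} (hφ : StrictMono φ)
    {α : ProbabilityMeasure (Fin k → ℝ)}
    (h : Tendsto (fun j => rescaledLaw d (a (φ j))) atTop (𝓝 α)) {y : Fin k → ℝ}
    (hy : ∑ i, y i = 0) : lossProb d α y ≤ 1 / 2 := by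
  obtain ⟨η, hη⟩ := exists_tendsto_rescale d hy
  let c : ℕ → ℝ := TopologicalSpace.denseSeq ℝ
  have hc : DenseRange c := TopologicalSpace.denseRange_denseSeq ℝ
  let ν : ProbabilityMeasure (Fin k → ℝ) :=
    (normalLaw k).map (continuous_limitDev d).measurable.aemeasurable
  -- Finiteness bounds the payoffs below, so that the infimum in `AsymptoticallyOptimal` is a lower
  -- bound for the payoff against `η`.
  have hfin : ∀ n, Finite (Allocation k n) := fun n => by
    refine Set.Finite.to_subtype ((Set.finite_Iic fun _ : Fin k => n).subset fun ξ hξ i => ?_)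
    have hξ' : ∑ i, ξ i = n := hξ
    exact hξ' ▸ Finset.single_le_sum (fun j _ => Nat.zero_le _) (Finset.mem_univ i)
  have hm : ∀ m, ((α.prod ν : ProbabilityMeasure _) : Measure ((Fin k → ℝ) × (Fin k → ℝ)))
      (earlySet d y c m) ≤ ENNReal.ofReal (1 / 2) := by
    intro m
    have hprod : Tendsto (fun j => (rescaledLaw d (a (φ j))).prod
        ((throwLaw d).map (measurable_countDev d (φ j)).aemeasurable)) atTop (𝓝 (α.prod ν)) :=
      (ProbabilityMeasure.continuous_prod.tendsto (α, ν)).comp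
        (h.prodMk_nhds ((tendsto_map_countDev d).comp hφ.tendsto_atTop))
    refine (ProbabilityMeasure.le_liminf_measure_open_of_tendsto hprod
      (isOpen_earlySet d y c m)).trans ?_
    -- The worst-case payoff tends to `0` and the exceptional event becomes negligible, so the upper
    -- bound tends to `1 / 2`.
    have hbound := (ENNReal.tendsto_ofReal (ha.const_sub (1 / 2))).add
      (tendsto_measure_exists_count_sub d c m
        (show (0 : ℝ) < 1 / ((m : ℝ) + 1) / 2 by positivity))
    rw [sub_zero, add_zero] at hbound
    refine (liminf_le_liminf ?_).trans_eq (hbound.comp hφ.tendsto_atTop).liminf_eq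
    filter_upwards [hφ.tendsto_atTop.eventually (eventually_measure_earlySet_le d c m hη)]
      with j hj
    refine (hj (a (φ j))).trans (add_le_add ?_ le_rfl)
    exact ENNReal.ofReal_le_ofReal (sub_le_sub_left
      (ciInf_le (Set.finite_range _).bddBelow (η (φ j))) _)
  have hsub : {q : (Fin k → ℝ) × (Fin k → ℝ) | contTime d y q.2 < contTime d q.1 q.2} ⊆
      Prod.map id (limitDev d) ⁻¹' ⋃ m, earlySet d y c m :=
    fun q hq => mem_iUnion_earlySet d hc hq
  have hmap : ((α.prod ν : ProbabilityMeasure _) : Measure ((Fin k → ℝ) × (Fin k → ℝ))) =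
      ((α : Measure (Fin k → ℝ)).prod (normals k)).map (Prod.map id (limitDev d)) := by
    rw [← Measure.map_prod_map _ _ measurable_id (continuous_limitDev d).measurable,
      Measure.map_id]
    rfl
  refine ENNReal.toReal_le_of_le_ofReal (by norm_num) ((measure_mono hsub).trans ?_)
  -- Continuity from below along the increasing early sets removes the margin and the restriction to
  -- finitely many times.
  rw [← Measure.map_apply (measurable_id.prodMap (continuous_limitDev d).measurable)
    (MeasurableSet.iUnion fun m => (isOpen_earlySet d y c m).measurableSet), ← hmap,
    (monotone_earlySet d y c).measure_iUnion]
  exact iSup_le hm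

end KnockEmDown

theorem theorem3p1 {k : ℕ} (d : KnockEmDown.Die k) :
    KnockEmDown.HasValue d 0 ∧
    (∃ α : ProbabilityMeasure (Fin k → ℝ), KnockEmDown.IsOptimal d α) ∧
    (∀ a : ∀ n : ℕ, KnockEmDown.TokenStrategy k n, KnockEmDown.AsymptoticallyOptimal d a →
      ∀ (φ : ℕ → ℕ) (α : ProbabilityMeasure (Fin k → ℝ)), StrictMono φ →
        Tendsto (fun j => KnockEmDown.rescaledLaw d (a (φ j))) atTop (𝓝 α) →
        KnockEmDown.IsOptimal d α) := by
  obtain ⟨α, hα⟩ := KnockEmDown.exists_isOptimal d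
  refine ⟨KnockEmDown.hasValue_zero_of_isOptimal d hα, ⟨α, hα⟩, fun a ha φ β hφ hβ => ?_⟩
  exact KnockEmDown.isOptimal_of_lossProb_le d (KnockEmDown.isContStrategy_of_tendsto d hβ)
    fun y hy => KnockEmDown.lossProb_le_of_tendsto d ha hφ hβ hy
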